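/- Let $d\in\mathbb N$. Let $\mathbb W_0$ be the Weyl $*$-algebra in $d$ degrees of freedom: the complex $*$-algebra with linear basis the monomials $u_\alpha v_\beta$ ($\alpha,\beta\in\mathbb R^d$), where $u_\alpha v_\beta=e^{i\alpha\cdot\beta}v_\beta u_\alpha$, $u_\alpha u_{\alpha'}=u_{\alpha+\alpha'}$, $v_\beta v_{\beta'}=v_{\beta+\beta'}$, $u_\alpha^*=u_{-\alpha}$, $v_\beta^*=v_{-\beta}$, and $u_0=v_0=\mathbf 1$. Let $\mathbb W$ be the Weyl $C^*$-algebra, i.e. the completion of $\mathbb W_0$ in the norm $\|a\|=\sup_\rho\|\rho(a)\|$, the supremum being over all $*$-representations $\rho$ of $\mathbb W_0$ by bounded operators on Hilbert spaces. A state is a positive normalized linear functional on $\mathbb W$, a pure state is an extreme point of the set of states, and sets of states carry the weak-$*$ topology. Let $\Gamma\subset\mathbb R^d$ be the lattice generated over $\mathbb Z$ by a basis of $\mathbb R^d$, let $\Gamma'=\{\gamma'\in\mathbb R^d:\gamma'\cdot\gamma\in2\pi\mathbb Z\ \ \forall\gamma\in\Gamma\}$, and put $\mathbb B_\Gamma=\mathbb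 R^d/\Gamma'$, $\mathbb T_\Gamma=\mathbb R^d/\Gamma$. A Zak state is a state $\omega$ of $\mathbb W$ with $\omega(v_\gamma u_{\gamma'}\,a\,u_{\gamma'}^*v_\gamma^*)=\omega(a)$ for all $a\in\mathbb W$, $\gamma\in\Gamma$, $\gamma'\in\Gamma'$; let $\mathscr S^{\rm Z}_{\mathbb W}$ be the set of Zak states. Let $\mathscr M_{+,1}(\mathbb B_\Gamma\times\mathbb T_\Gamma)$ be the set of Borel probability measures on the $2d$-torus $\mathbb B_\Gamma\times\mathbb T_\Gamma$, with the weak-$*$ topology (convergence of the integrals of continuous functions). For each $(\kappa,\nu)\in\mathbb B_\Gamma\times\mathbb T_\Gamma$ there is a pure Zak state $\omega_{(\kappa,\nu)}$ with $$\omega_{(\kappa,\nu)}(u_\alpha v_\beta)=\chi_{\Gamma'}(\alpha)\,\chi_\Gamma(\beta)\,e^{-i\kappa\cdot\beta}e^{-i\alpha\cdot\nu}\qquad(\alpha,\beta\in\mathbb R^d),$$ where $\chi$ denotes characteristic functions. For every Zak state $\omega$ there is a unique $\mu_\omega\in\mathscr M_{+,1}(\mathbb B_\Gamma\times\mathbb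 T_\Gamma)$ such that $$\omega(a)=\int_{\mathbb B_\Gamma\times\mathbb T_\Gamma}\omega_{(\kappa,\nu)}(a)\,d\mu_\omega(\kappa,\nu)\qquad\text{for all }a\in\mathbb W$$ (the integrands being integrable), and $\omega\mapsto\mu_\omega$ is a homeomorphism $\mathscr S^{\rm Z}_{\mathbb W}\simeq\mathscr M_{+,1}(\mathbb B_\Gamma\times\mathbb T_\Gamma)$. -/

import Mathlib

open scoped InnerProductSpace ComplexOrder

noncomputable section

namespace Weyl

/-- The Euclidean space `ℝ^d`. -/
abbrev E (d : ℕ) : Type := EuclideanSpace ℝ (Fin d)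

/-! ### The Weyl `*`-algebra -/

/-- The Weyl `*`-algebra `𝕎₀` in `d` degrees of freedom: formal finite complex linear combinations
of the monomials `u_α v_β`; the monomial `u_α v_β` is the basis vector at `(α, β)`. -/
def PreAlg (d : ℕ) : Type := (E d × E d) →₀ ℂ

namespace PreAlg

variable {d : ℕ}

instance : AddCommGroup (PreAlg d) := inferInstanceAs (AddCommGroup ((E d × E d) →₀ ℂ))
instance : Module ℂ (PreAlg d) := inferInstanceAs (Module ℂ ((E d × E d) →₀ ℂ))

/-- `mono z c` is `c • u_α v_β` for `z = (α, β)`. -/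
def mono (z : E d × E d) (c : ℂ) : PreAlg d := Finsupp.single z c

/-- The phase `exp (-i x)`. -/
def phase (x : ℝ) : ℂ := Complex.exp (-(Complex.I * (x : ℂ)))

theorem phase_add (x y : ℝ) : phase (x + y) = phase x * phase y := by
  unfold phase
  rw [← Complex.exp_add]
  congr 1
  push_cast
  ring

theorem phase_zero : phase 0 = 1 := by simp [phase]

theorem conj_phase (x : ℝ) : star (phase x) = phase (-x) := by
  unfold phase
  rw [Complex.star_def, ← Complex.exp_conj]
  congr 1
  simp

/-- The product, given on monomials by
`(u_α v_β) (u_α' v_β') = exp (-i α'·β) u_(α+α') v_(β+β')`. -/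
instance : Mul (PreAlg d) where
  mul f g := Finsupp.sum f fun z c => Finsupp.sum g fun z' c' =>
    mono (z + z') (c * c' * phase (⟪z'.1, z.2⟫_ℝ))

/-- The unit `u_0 v_0`. -/
instance : One (PreAlg d) where
  one := mono 0 1

/-- The involution, given on monomials by `(u_α v_β)* = exp (-i α·β) u_(-α) v_(-β)`. -/
instance : Star (PreAlg d) where
  star f := Finsupp.sum f fun z c => mono (-z) (star c * phase (⟪z.1, z.2⟫_ℝ))

theorem mul_def (f g : PreAlg d) : f * g = Finsupp.sum f fun z c => Finsupp.sum g fun z' c' =>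
    mono (z + z') (c * c' * phase (⟪z'.1, z.2⟫_ℝ)) := rfl

theorem star_def (f : PreAlg d) :
    star f = Finsupp.sum f fun z c => mono (-z) (star c * phase (⟪z.1, z.2⟫_ℝ)) := rfl

theorem one_def : (1 : PreAlg d) = mono 0 1 := rfl

theorem mono_zero (z : E d × E d) : mono z 0 = 0 := Finsupp.single_zero z

theorem mono_add (z : E d × E d) (c c' : ℂ) : mono z (c + c') = mono z c + mono z c' :=
  Finsupp.single_add z c c'

theorem smul_mono (r : ℂ) (z : E d × E d) (c : ℂ) : r • mono z c = mono z (r * c) :=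
  Finsupp.smul_single' r z c

theorem induct {p : PreAlg d → Prop} (f : PreAlg d) (h0 : p 0)
    (hadd : ∀ f g, p f → p g → p (f + g)) (hm : ∀ z c, p (mono z c)) : p f :=
  Finsupp.induction_linear f h0 hadd hm

theorem mono_mul_mono (z z' : E d × E d) (c c' : ℂ) :
    mono z c * mono z' c' = mono (z + z') (c * c' * phase (⟪z'.1, z.2⟫_ℝ)) := by
  rw [mul_def]
  refine (Finsupp.sum_single_index ?_).trans (Finsupp.sum_single_index ?_)
  · exact Finset.sum_eq_zero fun _ _ => by simp only [zero_mul, mono_zero]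
  · simp only [mul_zero, zero_mul, mono_zero]

theorem star_mono (z : E d × E d) (c : ℂ) :
    star (mono z c) = mono (-z) (star c * phase (⟪z.1, z.2⟫_ℝ)) := by
  rw [star_def]
  refine Finsupp.sum_single_index ?_
  simp only [star_zero, zero_mul, mono_zero]

protected theorem add_mul' (f g h : PreAlg d) : (f + g) * h = f * h + g * h := by
  simp only [mul_def]
  apply Finsupp.sum_add_index'
  · intro z
    exact Finset.sum_eq_zero fun _ _ => by simp only [zero_mul, mono_zero]
  · intro z c c'
    simp only [Finsupp.sum, ← Finset.sum_add_distrib, ← mono_add, add_mul]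

protected theorem mul_add' (f g h : PreAlg d) : f * (g + h) = f * g + f * h := by
  have key : ∀ z c, (Finsupp.sum (g + h) fun z' c' =>
      mono (z + z') (c * c' * phase (⟪z'.1, z.2⟫_ℝ)))
      = (Finsupp.sum g fun z' c' => mono (z + z') (c * c' * phase (⟪z'.1, z.2⟫_ℝ)))
        + Finsupp.sum h fun z' c' => mono (z + z') (c * c' * phase (⟪z'.1, z.2⟫_ℝ)) := by
    intro z c
    apply Finsupp.sum_add_index'
    · intro z'
      simp [mono_zero]
    · intro z' c1 c2
      rw [← mono_add]
      congr 1
      ring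
  simp only [mul_def]
  exact (Finset.sum_congr rfl fun z _ => key z _).trans Finset.sum_add_distrib

protected theorem star_add' (f g : PreAlg d) : star (f + g) = star f + star g := by
  simp only [star_def]
  apply Finsupp.sum_add_index'
  · intro z
    simp [mono_zero]
  · intro z c c'
    rw [← mono_add]
    congr 1
    rw [star_add]
    ring

protected theorem zero_mul' (f : PreAlg d) : 0 * f = 0 := Finsupp.sum_zero_index

protected theorem mul_zero' (f : PreAlg d) : f * 0 = 0 := by
  have := PreAlg.mul_add' f 0 0
  simpa using this

protected theorem star_zero' : star (0 : PreAlg d) = 0 := Finsupp.sum_zero_index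

protected theorem mul_assoc' (f g h : PreAlg d) : f * g * h = f * (g * h) := by
  induction f using induct with
  | h0 => simp only [PreAlg.zero_mul']
  | hadd f1 f2 h1 h2 => simp only [PreAlg.add_mul', h1, h2]
  | hm z c =>
    induction g using induct with
    | h0 => simp only [PreAlg.zero_mul', PreAlg.mul_zero']
    | hadd f1 f2 h1 h2 => simp only [PreAlg.add_mul', PreAlg.mul_add', h1, h2]
    | hm z' c' =>
      induction h using induct with
      | h0 => simp only [PreAlg.mul_zero']
      | hadd f1 f2 h1 h2 => simp only [PreAlg.mul_add', h1, h2]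
      | hm z'' c'' =>
        simp only [mono_mul_mono, add_assoc]
        congr 1
        simp only [Prod.fst_add, Prod.snd_add, inner_add_left, inner_add_right, phase_add]
        ring

instance : Ring (PreAlg d) :=
  { (inferInstance : AddCommGroup (PreAlg d)), (inferInstance : Mul (PreAlg d)),
    (inferInstance : One (PreAlg d)) with
    left_distrib := PreAlg.mul_add'
    right_distrib := PreAlg.add_mul'
    zero_mul := PreAlg.zero_mul'
    mul_zero := PreAlg.mul_zero'
    mul_assoc := PreAlg.mul_assoc'
    one_mul := fun f => by
      induction f using induct with
      | h0 => exact PreAlg.mul_zero' _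
      | hadd f1 f2 h1 h2 => rw [PreAlg.mul_add', h1, h2]
      | hm z c => rw [one_def, mono_mul_mono]; simp [phase_zero]
    mul_one := fun f => by
      induction f using induct with
      | h0 => exact PreAlg.zero_mul' _
      | hadd f1 f2 h1 h2 => rw [PreAlg.add_mul', h1, h2]
      | hm z c => rw [one_def, mono_mul_mono]; simp [phase_zero] }

instance : Algebra ℂ (PreAlg d) :=
  Algebra.ofModule
    (fun r f g => by
      induction f using induct with
      | h0 => simp
      | hadd f1 f2 h1 h2 => simp only [add_mul, smul_add, h1, h2]
      | hm z c =>
        induction g using induct with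
        | h0 => simp
        | hadd f1 f2 h1 h2 => simp only [mul_add, smul_add, h1, h2]
        | hm z' c' =>
          simp only [smul_mono, mono_mul_mono]
          congr 1
          ring)
    (fun r f g => by
      induction f using induct with
      | h0 => simp
      | hadd f1 f2 h1 h2 => simp only [add_mul, smul_add, h1, h2]
      | hm z c =>
        induction g using induct with
        | h0 => simp
        | hadd f1 f2 h1 h2 => simp only [mul_add, smul_add, h1, h2]
        | hm z' c' =>
          simp only [smul_mono, mono_mul_mono]
          congr 1
          ring)

instance : StarRing (PreAlg d) where
  star_involutive f := by
    induction f using induct with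
    | h0 => simp only [PreAlg.star_zero']
    | hadd f1 f2 h1 h2 => simp only [PreAlg.star_add', h1, h2]
    | hm z c =>
      simp only [star_mono, neg_neg, star_mul', star_star, conj_phase, Prod.fst_neg, Prod.snd_neg,
        inner_neg_neg]
      rw [mul_assoc, ← phase_add]
      simp [phase_zero]
  star_add := PreAlg.star_add'
  star_mul f g := by
    induction f using induct with
    | h0 => simp only [PreAlg.star_zero', zero_mul, mul_zero]
    | hadd f1 f2 h1 h2 => simp only [PreAlg.star_add', add_mul, mul_add, h1, h2]
    | hm z c =>
      induction g using induct with
      | h0 => simp only [PreAlg.star_zero', zero_mul, mul_zero]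
      | hadd f1 f2 h1 h2 => simp only [PreAlg.star_add', add_mul, mul_add, h1, h2]
      | hm z' c' =>
        simp only [mono_mul_mono, star_mono]
        rw [neg_add_rev]
        congr 1
        simp only [star_mul', conj_phase, Prod.fst_add, Prod.snd_add, inner_add_left,
          inner_add_right, Prod.fst_neg, Prod.snd_neg, inner_neg_neg, phase_add]
        have h : phase (-⟪z'.1, z.2⟫_ℝ) * phase (⟪z'.1, z.2⟫_ℝ) = 1 := by
          rw [← phase_add]
          simp [phase_zero]
        linear_combination (star c * star c' * phase (⟪z.1, z.2⟫_ℝ) * phase (⟪z.1, z'.2⟫_ℝ)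
          * phase (⟪z'.1, z'.2⟫_ℝ)) * h

instance : StarModule ℂ (PreAlg d) where
  star_smul r f := by
    induction f using induct with
    | h0 => simp
    | hadd f1 f2 h1 h2 => simp only [smul_add, star_add, h1, h2]
    | hm z c => simp only [smul_mono, star_mono, star_mul', mul_assoc]

/-! ### The minimal regular norm -/

/-- A `*`-representation of `𝕎₀` by bounded operators on a complex Hilbert space. -/
structure Rep (d : ℕ) where
  /-- the underlying space -/
  H : Type
  [normed : NormedAddCommGroup H]
  [inner : InnerProductSpace ℂ H]
  [complete : CompleteSpace H]
  /-- the representation -/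
  toHom : PreAlg d →⋆ₙₐ[ℂ] (H →L[ℂ] H)

attribute [instance] Rep.normed Rep.inner Rep.complete

instance : Nonempty (Rep d) := ⟨{ H := ℂ, toHom := 0 }⟩

theorem star_mono_mul_mono (z : E d × E d) : star (mono z 1) * mono z 1 = 1 := by
  rw [star_mono, mono_mul_mono, one_def]
  simp only [neg_add_cancel, star_one, one_mul, mul_one, Prod.snd_neg, inner_neg_right]
  rw [← phase_add]
  simp [phase_zero]

theorem Rep.norm_one_le (ρ : Rep d) : ‖ρ.toHom 1‖ ≤ 1 := by
  have h : ‖ρ.toHom 1‖ * ‖ρ.toHom 1‖ = ‖ρ.toHom 1‖ := by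
    rw [← CStarRing.norm_star_mul_self, ← map_star, ← map_mul, star_one, one_mul]
  nlinarith [norm_nonneg (ρ.toHom 1)]

theorem Rep.norm_mono_le (ρ : Rep d) (z : E d × E d) : ‖ρ.toHom (mono z 1)‖ ≤ 1 := by
  have h : ‖ρ.toHom (mono z 1)‖ * ‖ρ.toHom (mono z 1)‖ = ‖ρ.toHom 1‖ := by
    rw [← CStarRing.norm_star_mul_self, ← map_star, ← map_mul, star_mono_mul_mono]
  nlinarith [norm_nonneg (ρ.toHom (mono z 1)), ρ.norm_one_le]

theorem exists_bound (f : PreAlg d) : ∃ C : ℝ, ∀ ρ : Rep d, ‖ρ.toHom f‖ ≤ C := by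
  induction f using induct with
  | h0 => exact ⟨0, fun ρ => by simp⟩
  | hadd f g hf hg =>
    obtain ⟨C, hC⟩ := hf
    obtain ⟨C', hC'⟩ := hg
    refine ⟨C + C', fun ρ => ?_⟩
    rw [map_add]
    exact (norm_add_le _ _).trans (add_le_add (hC ρ) (hC' ρ))
  | hm z c =>
    refine ⟨‖c‖, fun ρ => ?_⟩
    have : mono z c = c • mono z 1 := by rw [smul_mono, mul_one]
    rw [this, map_smul, norm_smul]
    exact mul_le_of_le_one_right (norm_nonneg c) (ρ.norm_mono_le z)

/-- The minimal regular norm `‖a‖ = sup_ρ ‖ρ(a)‖`, the supremum over all `*`-representations. -/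
instance : Norm (PreAlg d) where
  norm a := ⨆ ρ : Rep d, ‖ρ.toHom a‖

theorem norm_def (a : PreAlg d) : ‖a‖ = ⨆ ρ : Rep d, ‖ρ.toHom a‖ := rfl

theorem bddAbove (a : PreAlg d) : BddAbove (Set.range fun ρ : Rep d => ‖ρ.toHom a‖) := by
  obtain ⟨C, hC⟩ := exists_bound a
  exact ⟨C, by rintro _ ⟨ρ, rfl⟩; exact hC ρ⟩

theorem Rep.norm_le (ρ : Rep d) (a : PreAlg d) : ‖ρ.toHom a‖ ≤ ‖a‖ := le_ciSup (bddAbove a) ρ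

protected theorem norm_le' {a : PreAlg d} {C : ℝ} (h : ∀ ρ : Rep d, ‖ρ.toHom a‖ ≤ C) : ‖a‖ ≤ C :=
  ciSup_le h

protected theorem norm_nonneg' (a : PreAlg d) : 0 ≤ ‖a‖ :=
  Real.iSup_nonneg fun _ => norm_nonneg _

instance : SeminormedRing (PreAlg d) :=
  { (inferInstance : Ring (PreAlg d)),
    SeminormedAddCommGroup.ofCore (𝕜 := ℂ) (E := PreAlg d)
      { norm_nonneg := PreAlg.norm_nonneg'
        norm_smul := fun c a => by
          simp only [norm_def, map_smul, norm_smul]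
          rw [Real.mul_iSup_of_nonneg (norm_nonneg c)]
        norm_triangle := fun a b => PreAlg.norm_le' fun ρ => by
          rw [map_add]
          exact (norm_add_le _ _).trans (add_le_add (ρ.norm_le a) (ρ.norm_le b)) } with
    norm_mul_le := fun a b => PreAlg.norm_le' fun ρ => by
      rw [map_mul]
      exact (norm_mul_le _ _).trans
        (mul_le_mul (ρ.norm_le a) (ρ.norm_le b) (norm_nonneg _) (PreAlg.norm_nonneg' a)) }

instance : NormedAlgebra ℂ (PreAlg d) where
  norm_smul_le c a := PreAlg.norm_le' fun ρ => by
    rw [map_smul, norm_smul]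
    exact mul_le_mul_of_nonneg_left (ρ.norm_le a) (norm_nonneg c)

instance : NormedStarGroup (PreAlg d) where
  norm_star_le a := PreAlg.norm_le' fun ρ => by
    rw [map_star, norm_star]
    exact ρ.norm_le a

theorem norm_mul_self_le (a : PreAlg d) : ‖a‖ * ‖a‖ ≤ ‖star a * a‖ := by
  have h : ‖a‖ ≤ √‖star a * a‖ := PreAlg.norm_le' fun ρ => by
    apply Real.le_sqrt_of_sq_le
    rw [sq, ← CStarRing.norm_star_mul_self, ← map_star, ← map_mul]
    exact ρ.norm_le _
  calc ‖a‖ * ‖a‖ ≤ √‖star a * a‖ * √‖star a * a‖ :=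
        mul_le_mul h h (norm_nonneg _) (Real.sqrt_nonneg _)
    _ = ‖star a * a‖ := Real.mul_self_sqrt (norm_nonneg _)

end PreAlg

/-! ### The Weyl `C*`-algebra -/

/-- The Weyl `C*`-algebra `𝕎`: the completion of `𝕎₀` in the minimal regular norm. -/
def Alg (d : ℕ) : Type := UniformSpace.Completion (PreAlg d)

namespace Alg

variable {d : ℕ}

instance : NormedRing (Alg d) := inferInstanceAs (NormedRing (UniformSpace.Completion (PreAlg d)))
instance : CompleteSpace (Alg d) :=
  inferInstanceAs (CompleteSpace (UniformSpace.Completion (PreAlg d)))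
instance : Algebra ℂ (Alg d) := inferInstanceAs (Algebra ℂ (UniformSpace.Completion (PreAlg d)))

/-- The canonical map `𝕎₀ → 𝕎`. -/
def of (a : PreAlg d) : Alg d := (a : UniformSpace.Completion (PreAlg d))

theorem of_add (a b : PreAlg d) : of (a + b) = of a + of b := UniformSpace.Completion.coe_add a b
theorem of_mul (a b : PreAlg d) : of (a * b) = of a * of b := UniformSpace.Completion.coe_mul a b
theorem of_smul (c : ℂ) (a : PreAlg d) : of (c • a) = c • of a :=
  UniformSpace.Completion.coe_smul c a
theorem norm_of (a : PreAlg d) : ‖of a‖ = ‖a‖ := UniformSpace.Completion.norm_coe a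
theorem continuous_of : Continuous (of : PreAlg d → Alg d) :=
  UniformSpace.Completion.continuous_coe _
theorem denseRange_of : DenseRange (of : PreAlg d → Alg d) :=
  UniformSpace.Completion.denseRange_coe

instance : NormedAlgebra ℂ (Alg d) where
  norm_smul_le c a :=
    norm_smul_le (α := ℂ) (β := UniformSpace.Completion (PreAlg d)) c a

/-- The involution of `𝕎` is the continuous extension of that of `𝕎₀`. -/
instance : Star (Alg d) where
  star := UniformSpace.Completion.map (star : PreAlg d → PreAlg d)

theorem uniformContinuous_star' : UniformContinuous (star : PreAlg d → PreAlg d) :=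
  star_isometry.uniformContinuous

protected theorem continuous_star' : Continuous (star : Alg d → Alg d) :=
  UniformSpace.Completion.continuous_map

theorem of_star (a : PreAlg d) : of (star a) = star (of a) :=
  (UniformSpace.Completion.map_coe uniformContinuous_star' a).symm

theorem induct {p : Alg d → Prop} (a : Alg d) (hp : IsClosed {a | p a})
    (h : ∀ a, p (of a)) : p a :=
  UniformSpace.Completion.induction_on a hp h

theorem induct₂ {p : Alg d → Alg d → Prop} (a b : Alg d)
    (hp : IsClosed {x : Alg d × Alg d | p x.1 x.2})
    (h : ∀ a b, p (of a) (of b)) : p a b :=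
  UniformSpace.Completion.induction_on₂ a b hp h

instance : StarRing (Alg d) where
  star_involutive a := by
    induction a using induct with
    | hp => exact isClosed_eq (Alg.continuous_star'.comp Alg.continuous_star') continuous_id
    | h a => rw [← of_star, ← of_star, star_star]
  star_add a b := by
    induction a, b using induct₂ with
    | hp =>
      exact isClosed_eq (Alg.continuous_star'.comp (continuous_fst.add continuous_snd))
        ((Alg.continuous_star'.comp continuous_fst).add (Alg.continuous_star'.comp continuous_snd))
    | h a b => rw [← of_add, ← of_star, ← of_star, ← of_star, star_add, of_add]
  star_mul a b := by
    induction a, b using induct₂ with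
    | hp =>
      exact isClosed_eq (Alg.continuous_star'.comp (continuous_fst.mul continuous_snd))
        ((Alg.continuous_star'.comp continuous_snd).mul (Alg.continuous_star'.comp continuous_fst))
    | h a b => rw [← of_mul, ← of_star, ← of_star, ← of_star, star_mul, of_mul]

instance : StarModule ℂ (Alg d) where
  star_smul c a := by
    induction a using induct with
    | hp =>
      exact isClosed_eq (Alg.continuous_star'.comp (continuous_id.const_smul c))
        (Alg.continuous_star'.const_smul (star c))
    | h a => rw [← of_smul, ← of_star, ← of_star, star_smul, of_smul]

instance : CStarRing (Alg d) where
  norm_mul_self_le a := by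
    induction a using induct with
    | hp =>
      exact isClosed_le (continuous_norm.mul continuous_norm)
        (continuous_norm.comp (Alg.continuous_star'.mul continuous_id))
    | h a =>
      rw [← of_star, ← of_mul, norm_of, norm_of]
      exact PreAlg.norm_mul_self_le a

instance : CStarAlgebra (Alg d) where

/-- The generator `u_α`. -/
def u (α : E d) : Alg d := of (PreAlg.mono (α, 0) 1)

/-- The generator `v_β`. -/
def v (β : E d) : Alg d := of (PreAlg.mono (0, β) 1)

/-- The space translation `τ_lam (a) = v_lam a v_lam*`. -/
def tau (lam : E d) (a : Alg d) : Alg d := v lam * a * star (v lam)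

/-- The momentum translation `θ_α (a) = u_α a u_α*`. -/
def theta (α : E d) (a : Alg d) : Alg d := u α * a * star (u α)

end Alg

/-! ### States -/

/-- The state space of a unital `C*`-algebra: the positive normalized linear functionals, inside
the dual with its weak-`*` topology. -/
def stateSpace (A : Type*) [CStarAlgebra A] : Set (WeakDual ℂ A) :=
  {ω | (∀ a : A, 0 ≤ ω (star a * a)) ∧ ω 1 = 1}

/-- The pure states: the extremal points of the state space. -/
def pureStates (A : Type*) [CStarAlgebra A] : Set (WeakDual ℂ A) :=
  (stateSpace A).extremePoints ℝ

/-! ### Lattices and tori -/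

section Lattice

variable {d : ℕ} (e : Module.Basis (Fin d) ℝ (E d))

/-- The lattice `Γ = ℤ e₁ + … + ℤ e_d` of a basis of `ℝ^d`. -/
def lattice : AddSubgroup (E d) := AddSubgroup.closure (Set.range e)

/-- The dual lattice `Γ' = {γ' | γ'·γ ∈ 2πℤ for all γ ∈ Γ}`. -/
def dualLattice : AddSubgroup (E d) where
  carrier := {γ' | ∀ γ ∈ lattice e, ∃ n : ℤ, ⟪γ', γ⟫_ℝ = 2 * Real.pi * n}
  zero_mem' := fun γ _ => ⟨0, by simp⟩
  add_mem' := by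
    intro a b ha hb γ hγ
    obtain ⟨m, hm⟩ := ha γ hγ
    obtain ⟨n, hn⟩ := hb γ hγ
    exact ⟨m + n, by rw [inner_add_left, hm, hn]; push_cast; ring⟩
  neg_mem' := by
    intro a ha γ hγ
    obtain ⟨m, hm⟩ := ha γ hγ
    exact ⟨-m, by rw [inner_neg_left, hm]; push_cast; ring⟩

/-- The `2d`-dimensional torus `𝔹_Γ × 𝕋_Γ = (ℝ^d / Γ') × (ℝ^d / Γ)`, with the product of the
quotient topologies and its Borel `σ`-algebra. -/
def Torus : Type := (E d ⧸ dualLattice e) × (E d ⧸ lattice e)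

instance : TopologicalSpace (Torus e) :=
  inferInstanceAs (TopologicalSpace ((E d ⧸ dualLattice e) × (E d ⧸ lattice e)))
instance : MeasurableSpace (Torus e) := borel (Torus e)
instance : BorelSpace (Torus e) := ⟨rfl⟩

/-- The point of the torus represented by `κ, ν ∈ ℝ^d`. -/
def Torus.mk (κ ν : E d) : Torus e := (QuotientAddGroup.mk κ, QuotientAddGroup.mk ν)

/-- The Zak states: the states of the Weyl `C*`-algebra with `ω ∘ τ_γ ∘ θ_γ' = ω` for all
`γ ∈ Γ` and `γ' ∈ Γ'`. -/
def zakStates : Set (WeakDual ℂ (Alg d)) :=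
  {ω | ω ∈ stateSpace (Alg d) ∧ ∀ γ ∈ lattice e, ∀ γ' ∈ dualLattice e, ∀ a : Alg d,
    ω (Alg.tau γ (Alg.theta γ' a)) = ω a}

/-- The pure Zak states. -/
def pureZakStates : Set (WeakDual ℂ (Alg d)) := zakStates e ∩ pureStates (Alg d)

end Lattice

end Weyl

end

noncomputable section

namespace Weyl

open PreAlg (phase phase_add phase_zero mono)

/-! Conjugating a monomial by another multiplies it by a symplectic phase, and `Γ' × Γ` is its own
annihilator for that phase. Zak invariance therefore kills every monomial off `Γ' × Γ`
(`zakState_weyl_eq_zero`), so a Zak state is determined by its restriction to `zakAlg`, the algebra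
generated by the monomials of `Γ' × Γ`. These multiply without phase, so `zakAlg` is commutative.

A character of `zakAlg` extends to a state by Hahn–Banach. The extension has modulus one at the
unitary lattice monomials, hence is multiplicative there; this makes it Zak and pure
(`mem_zakStates_of_chi`, `mem_pureStates_of_chi`). Some character exists because `zakAlg` is
nonzero, and conjugating its extension by a Weyl monomial moves it to any prescribed `(κ, ν)`
(`exists_chi_state`). So the torus maps continuously and bijectively onto the character space; being
compact, it is homeomorphic to it, and Gelfand duality gives `zakAlg ≃ C(Torus)`.

Under this identification the restriction of a Zak state to `zakAlg` is a probability measure by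
Riesz–Markov, and integrating the pure Zak states against that measure returns the state
(`exists_barycenter_eq`). Both directions are continuous because each side is tested against
continuous functions on the torus. -/

theorem phase_eq_one_iff (x : ℝ) : phase x = 1 ↔ ∃ n : ℤ, x = 2 * Real.pi * n := by
  have hI := Complex.I_ne_zero
  rw [phase, Complex.exp_eq_one_iff]
  constructor
  · rintro ⟨n, hn⟩
    refine ⟨-n, ?_⟩
    have h : Complex.I * (x : ℂ) = Complex.I * ((2 * Real.pi * (-n : ℤ) : ℝ) : ℂ) := by
      push_cast
      linear_combination -hn
    exact_mod_cast mul_left_cancel₀ hI h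
  · rintro ⟨n, rfl⟩
    refine ⟨-n, ?_⟩
    push_cast
    ring

theorem norm_phase (x : ℝ) : ‖phase x‖ = 1 := by
  have h : -(Complex.I * (x : ℂ)) = ((-x : ℝ) : ℂ) * Complex.I := by push_cast; ring
  rw [phase, h, Complex.norm_exp_ofReal_mul_I]

theorem phase_ne_zero (x : ℝ) : phase x ≠ 0 := Complex.exp_ne_zero _

theorem phase_neg_mul (x : ℝ) : phase (-x) * phase x = 1 := by
  rw [← phase_add, neg_add_cancel, phase_zero]

theorem continuous_phase : Continuous phase := by
  unfold phase
  fun_prop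

theorem exists_phase_eq {c : ℂ} (hc : ‖c‖ = 1) : ∃ θ : ℝ, phase θ = c := by
  refine ⟨-c.arg, ?_⟩
  have h := Complex.norm_mul_exp_arg_mul_I c
  rw [hc, Complex.ofReal_one, one_mul] at h
  rw [phase]
  conv_rhs => rw [← h]
  congr 1
  push_cast
  ring

/-! ### Dual lattices, their characters and the torus -/

section Lattice

variable {d : ℕ}

/-- A unimodular character of the group generated by vectors that have dual vectors is given by a
phase. -/
theorem exists_eq_phase_inner {f g : Fin d → E d}
    (h : ∀ i j, ⟪f i, g j⟫_ℝ = if i = j then 2 * Real.pi else 0) {χ : E d → ℂ}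
    (hmul : ∀ x ∈ AddSubgroup.closure (Set.range g), ∀ y ∈ AddSubgroup.closure (Set.range g),
      χ (x + y) = χ x * χ y)
    (hnorm : ∀ x ∈ AddSubgroup.closure (Set.range g), ‖χ x‖ = 1) :
    ∃ κ : E d, ∀ x ∈ AddSubgroup.closure (Set.range g), χ x = phase ⟪κ, x⟫_ℝ := by
  have hg (i) : g i ∈ AddSubgroup.closure (Set.range g) :=
    AddSubgroup.subset_closure (Set.mem_range_self i)
  choose θ hθ using fun i => exists_phase_eq (hnorm _ (hg i))
  have h0 : χ 0 = 1 := by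
    have h1 := hmul 0 (zero_mem _) 0 (zero_mem _)
    have h2 : χ 0 ≠ 0 := by
      rw [← norm_ne_zero_iff, hnorm 0 (zero_mem _)]
      exact one_ne_zero
    rw [add_zero] at h1
    exact mul_left_cancel₀ h2 (by rw [← h1, mul_one])
  refine ⟨∑ i, (θ i / (2 * Real.pi)) • f i, fun x hx => ?_⟩
  induction hx using AddSubgroup.closure_induction with
  | mem x hx =>
    obtain ⟨j, rfl⟩ := hx
    rw [← hθ j]
    congr 1
    simp [sum_inner, inner_smul_left, h]
  | zero => rw [inner_zero_right, phase_zero, h0]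
  | add x y hx hy h1 h2 => rw [hmul x hx y hy, h1, h2, inner_add_right, phase_add]
  | neg x hx h1 =>
    have h2 := hmul (-x) (neg_mem hx) x hx
    rw [neg_add_cancel, h0, h1] at h2
    rw [inner_neg_right]
    exact mul_right_cancel₀ (phase_ne_zero ⟪_, x⟫_ℝ) (by rw [← h2, phase_neg_mul])

/-- The unit cube of coefficients already covers the quotient: integer parts of coefficients
contribute elements of `N`. -/
theorem compactSpace_quotient {g : Fin d → E d} {N : AddSubgroup (E d)} (hg : ∀ i, g i ∈ N)
    (hspan : ∀ x : E d, ∃ c : Fin d → ℝ, x = ∑ i, c i • g i) : CompactSpace (E d ⧸ N) := by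
  let F : (Fin d → ℝ) → E d ⧸ N := fun c => QuotientAddGroup.mk (∑ i, c i • g i)
  have hF : Continuous F := by
    refine continuous_quotient_mk'.comp ?_
    fun_prop
  have hK : IsCompact (F '' Set.Icc 0 1) := isCompact_Icc.image hF
  suffices F '' Set.Icc 0 1 = Set.univ from ⟨this ▸ hK⟩
  refine Set.eq_univ_of_forall fun q => ?_
  induction q using QuotientAddGroup.induction_on with
  | H x =>
  obtain ⟨c, rfl⟩ := hspan x
  refine ⟨fun i => Int.fract (c i), ⟨fun i => Int.fract_nonneg _,
    fun i => (Int.fract_lt_one _).le⟩, ?_⟩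
  refine (QuotientAddGroup.eq).2 ?_
  have : -∑ i, Int.fract (c i) • g i + ∑ i, c i • g i = ∑ i, ⌊c i⌋ • g i := by
    rw [neg_add_eq_sub, ← Finset.sum_sub_distrib]
    refine Finset.sum_congr rfl fun i _ => ?_
    rw [← sub_smul, Int.self_sub_fract, Int.cast_smul_eq_zsmul]
  rw [this]
  exact sum_mem fun i _ => zsmul_mem (hg i) _

variable (e : Module.Basis (Fin d) ℝ (E d))

/-- The vectors `f i` with `⟪f i, e j⟫ = 2π δ_ij`. -/
def dualVec (i : Fin d) : E d :=
  (InnerProductSpace.toDual ℝ (E d)).symm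
    (LinearMap.toContinuousLinearMap ((2 * Real.pi) • e.coord i))

theorem inner_dualVec (i : Fin d) (x : E d) : ⟪dualVec e i, x⟫_ℝ = 2 * Real.pi * e.repr x i := by
  rw [dualVec, InnerProductSpace.toDual_symm_apply]
  simp

theorem inner_dualVec_basis (i j : Fin d) :
    ⟪dualVec e i, e j⟫_ℝ = if i = j then 2 * Real.pi else 0 := by
  rw [inner_dualVec, e.repr_self, Finsupp.single_apply]
  simp [eq_comm]

theorem eq_sum_dualVec (x : E d) : x = ∑ i, (⟪x, e i⟫_ℝ / (2 * Real.pi)) • dualVec e i := by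
  refine ext_inner_right ℝ fun y => ?_
  conv_lhs => rw [← e.sum_repr y]
  have hpi := Real.pi_ne_zero
  simp only [inner_sum, sum_inner, inner_smul_left, inner_smul_right, inner_dualVec]
  refine Finset.sum_congr rfl fun i _ => ?_
  simp only [conj_trivial]
  field_simp

theorem basis_mem_lattice (i : Fin d) : e i ∈ lattice e :=
  AddSubgroup.subset_closure (Set.mem_range_self i)

theorem mem_lattice_of_repr {x : E d} (h : ∀ i, ∃ n : ℤ, e.repr x i = n) : x ∈ lattice e := by
  choose n hn using h
  rw [← e.sum_repr x]
  simp only [hn, Int.cast_smul_eq_zsmul]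
  exact sum_mem fun i _ => zsmul_mem (basis_mem_lattice e i) _

theorem repr_of_mem_lattice {x : E d} (hx : x ∈ lattice e) (i : Fin d) :
    ∃ n : ℤ, e.repr x i = n := by
  induction hx using AddSubgroup.closure_induction with
  | mem x hx =>
    obtain ⟨j, rfl⟩ := hx
    refine ⟨if j = i then 1 else 0, ?_⟩
    rw [e.repr_self, Finsupp.single_apply]
    split_ifs <;> simp
  | zero => exact ⟨0, by simp⟩
  | add x y _ _ h1 h2 =>
    obtain ⟨m, hm⟩ := h1
    obtain ⟨n, hn⟩ := h2
    exact ⟨m + n, by simp [hm, hn]⟩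
  | neg x _ h1 =>
    obtain ⟨m, hm⟩ := h1
    exact ⟨-m, by simp [hm]⟩

theorem dualVec_mem (i : Fin d) : dualVec e i ∈ dualLattice e := fun γ hγ => by
  obtain ⟨n, hn⟩ := repr_of_mem_lattice e hγ i
  exact ⟨n, by rw [inner_dualVec, hn]⟩

theorem mem_closure_dualVec {x : E d} (hx : x ∈ dualLattice e) :
    x ∈ AddSubgroup.closure (Set.range (dualVec e)) := by
  choose n hn using fun i => hx (e i) (basis_mem_lattice e i)
  rw [eq_sum_dualVec e x]
  refine sum_mem fun i _ => ?_
  have hpi := Real.pi_ne_zero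
  rw [hn i, mul_div_cancel_left₀ _ (by positivity), Int.cast_smul_eq_zsmul]
  exact zsmul_mem (AddSubgroup.subset_closure (Set.mem_range_self i)) _

theorem closure_dualVec_le : AddSubgroup.closure (Set.range (dualVec e)) ≤ dualLattice e := by
  rw [AddSubgroup.closure_le]
  rintro _ ⟨i, rfl⟩
  exact dualVec_mem e i

theorem mem_dualLattice_of_phase {x : E d} (h : ∀ γ ∈ lattice e, phase ⟪x, γ⟫_ℝ = 1) :
    x ∈ dualLattice e := fun γ hγ => (phase_eq_one_iff _).1 (h γ hγ)

/-- Double duality: testing against `dualVec e i` alone reads off the `i`-th coordinate and shows it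
to be an integer. -/
theorem mem_lattice_of_phase {x : E d} (h : ∀ γ ∈ dualLattice e, phase ⟪γ, x⟫_ℝ = 1) :
    x ∈ lattice e := by
  refine mem_lattice_of_repr e fun i => ?_
  obtain ⟨n, hn⟩ := (phase_eq_one_iff _).1 (h _ (dualVec_mem e i))
  rw [inner_dualVec] at hn
  have hpi := Real.pi_ne_zero
  exact ⟨n, mul_left_cancel₀ (by positivity) hn⟩

theorem phase_inner_of_mem {x y : E d} (hx : x ∈ dualLattice e) (hy : y ∈ lattice e) :
    phase ⟪x, y⟫_ℝ = 1 := (phase_eq_one_iff _).2 (hx y hy)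

instance : CompactSpace (E d ⧸ lattice e) :=
  compactSpace_quotient (basis_mem_lattice e) fun x => ⟨e.repr x, (e.sum_repr x).symm⟩

instance : CompactSpace (E d ⧸ dualLattice e) :=
  compactSpace_quotient (dualVec_mem e) fun x => ⟨_, eq_sum_dualVec e x⟩

instance : CompactSpace (Torus e) :=
  inferInstanceAs (CompactSpace ((E d ⧸ dualLattice e) × (E d ⧸ lattice e)))

instance : SecondCountableTopology (Torus e) :=
  inferInstanceAs (SecondCountableTopology ((E d ⧸ dualLattice e) × (E d ⧸ lattice e)))

/-- The subgroup `Γ' × Γ` of the phase space. -/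
def phaseLattice : AddSubgroup (E d × E d) := (dualLattice e).prod (lattice e)

theorem mem_phaseLattice {z : E d × E d} :
    z ∈ phaseLattice e ↔ z.1 ∈ dualLattice e ∧ z.2 ∈ lattice e := Iff.rfl

/-- The character `z ↦ exp (-i (κ·z₂ + z₁·ν))` of the phase space. -/
def chi (κ ν : E d) (z : E d × E d) : ℂ := phase ⟪κ, z.2⟫_ℝ * phase ⟪z.1, ν⟫_ℝ

theorem norm_chi (κ ν : E d) (z : E d × E d) : ‖chi κ ν z‖ = 1 := by
  rw [chi, norm_mul, norm_phase, norm_phase, mul_one]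

theorem chi_add_left (κ ν κ' ν' : E d) (z : E d × E d) :
    chi (κ + κ') (ν + ν') z = chi κ ν z * chi κ' ν' z := by
  simp only [chi, inner_add_left, inner_add_right, phase_add]
  ring

/-- This is the maximality of `Γ' × Γ` as an isotropic subgroup; the vectors `(0, γ)` and `(-γ', 0)`
test the two components of `z` separately. -/
theorem exists_chi_ne_one {z : E d × E d} (hz : z ∉ phaseLattice e) :
    ∃ l ∈ phaseLattice e, phase (⟪z.1, l.2⟫_ℝ - ⟪l.1, z.2⟫_ℝ) ≠ 1 := by
  by_contra! h
  refine hz ⟨mem_dualLattice_of_phase e fun γ hγ => ?_, mem_lattice_of_phase e fun γ hγ => ?_⟩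
  · simpa using h (0, γ) ⟨zero_mem _, hγ⟩
  · simpa using h (-γ, 0) ⟨(dualLattice e).neg_mem hγ, zero_mem _⟩

/-- The two factors are treated separately by `exists_eq_phase_inner`, with `e` and `dualVec e`
exchanging their roles. -/
theorem exists_eq_chi {χ : E d × E d → ℂ}
    (hmul : ∀ x ∈ phaseLattice e, ∀ y ∈ phaseLattice e, χ (x + y) = χ x * χ y)
    (hnorm : ∀ x ∈ phaseLattice e, ‖χ x‖ = 1) :
    ∃ κ ν : E d, ∀ x ∈ phaseLattice e, χ x = chi κ ν x := by
  have h1 {x : E d} (hx : x ∈ lattice e) : ((0, x) : E d × E d) ∈ phaseLattice e :=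
    ⟨zero_mem _, hx⟩
  have h2 {x : E d} (hx : x ∈ dualLattice e) : ((x, 0) : E d × E d) ∈ phaseLattice e :=
    ⟨hx, zero_mem _⟩
  obtain ⟨κ, hκ⟩ := exists_eq_phase_inner (inner_dualVec_basis e) (χ := fun x => χ (0, x))
    (fun x hx y hy => by simpa using hmul _ (h1 hx) _ (h1 hy)) (fun x hx => hnorm _ (h1 hx))
  obtain ⟨ν, hν⟩ := exists_eq_phase_inner (f := e) (g := dualVec e)
    (fun i j => by rw [real_inner_comm, inner_dualVec_basis]; simp [eq_comm])
    (χ := fun x => χ (x, 0))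
    (fun x hx y hy => by
      simpa using hmul _ (h2 (closure_dualVec_le e hx)) _ (h2 (closure_dualVec_le e hy)))
    (fun x hx => hnorm _ (h2 (closure_dualVec_le e hx)))
  refine ⟨κ, ν, fun x hx => ?_⟩
  have h3 := hmul _ (h1 hx.2) _ (h2 hx.1)
  simp only [Prod.mk_add_mk, zero_add, add_zero] at h3
  rw [chi, ← hκ _ hx.2, real_inner_comm, ← hν _ (mem_closure_dualVec e hx.1)]
  exact h3

theorem Torus.mk_surjective (p : Torus e) : ∃ κ ν : E d, Torus.mk e κ ν = p := by
  obtain ⟨κ, h1⟩ := QuotientAddGroup.mk_surjective p.1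
  obtain ⟨ν, h2⟩ := QuotientAddGroup.mk_surjective p.2
  exact ⟨κ, ν, Prod.ext h1 h2⟩

/-- The quotient of the two characters is the character of the differences, and it is trivial on `Γ'
× Γ` exactly when these lie in `Γ'` and `Γ`, by double duality. -/
theorem Torus.mk_eq_iff {κ ν κ' ν' : E d} :
    Torus.mk e κ ν = Torus.mk e κ' ν' ↔ ∀ l ∈ phaseLattice e, chi κ ν l = chi κ' ν' l := by
  have key : Torus.mk e κ ν = Torus.mk e κ' ν' ↔
      -κ + κ' ∈ dualLattice e ∧ -ν + ν' ∈ lattice e := by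
    rw [← QuotientAddGroup.eq, ← QuotientAddGroup.eq]
    exact Prod.mk_inj
  have h1 (l) : chi κ' ν' l = chi κ ν l * chi (-κ + κ') (-ν + ν') l := by
    rw [← chi_add_left, add_neg_cancel_left, add_neg_cancel_left]
  rw [key]
  constructor
  · rintro ⟨h2, h3⟩ l hl
    have h4 : chi (-κ + κ') (-ν + ν') l = 1 := by
      rw [chi, phase_inner_of_mem e h2 hl.2, phase_inner_of_mem e hl.1 h3, mul_one]
    rw [h1, h4, mul_one]
  · intro h
    have h2 (l) (hl : l ∈ phaseLattice e) : chi (-κ + κ') (-ν + ν') l = 1 := by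
      have h0 : chi κ ν l ≠ 0 := by
        rw [← norm_ne_zero_iff, norm_chi]
        exact one_ne_zero
      have h3 := h1 l
      rw [← h l hl] at h3
      exact mul_left_cancel₀ h0 (by rw [← h3, mul_one])
    refine ⟨mem_dualLattice_of_phase e fun γ hγ => ?_, mem_lattice_of_phase e fun γ hγ => ?_⟩
    · simpa [chi, phase_zero] using h2 (0, γ) ⟨zero_mem _, hγ⟩
    · simpa [chi, phase_zero] using h2 (γ, 0) ⟨hγ, zero_mem _⟩

end Lattice

/-! ### A nonzero representation, on `ℓ²` of the discrete space -/

section RegularRepresentation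

variable {d : ℕ}

/-- The Hilbert space of square summable functions on `ℝ^d`. -/
abbrev L2 (d : ℕ) : Type := lp (fun _ : E d => ℂ) 2

theorem memLp_weyl (z : E d × E d) (f : L2 d) :
    Memℓp (fun x : E d => phase (-⟪z.1, x⟫_ℝ) * f (x - z.2)) 2 := by
  have h := (lp.memℓp f).summable (by norm_num)
  refine memℓp_gen ?_
  simp only [norm_mul, norm_phase, one_mul]
  exact (Equiv.subRight z.2).summable_iff.2 h

/-- The operator `f ↦ exp (i z₁·x) f (x - z₂)`. -/
def weylOp (z : E d × E d) : L2 d →ₗᵢ[ℂ] L2 d where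
  toFun f := ⟨_, memLp_weyl z f⟩
  map_add' f g := by
    ext x
    exact mul_add _ _ _
  map_smul' c f := by
    ext x
    simp only [lp.coeFn_smul, Pi.smul_apply, smul_eq_mul, RingHom.id_apply]
    ring
  norm_map' f := by
    rw [lp.norm_eq_tsum_rpow (by norm_num), lp.norm_eq_tsum_rpow (by norm_num)]
    congr 1
    simp only [LinearMap.coe_mk, AddHom.coe_mk, norm_mul, norm_phase, one_mul]
    exact (Equiv.subRight z.2).tsum_eq fun x => ‖f x‖ ^ (2 : ENNReal).toReal

theorem weylOp_apply (z : E d × E d) (f : L2 d) (x : E d) :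
    weylOp z f x = phase (-⟪z.1, x⟫_ℝ) * f (x - z.2) := rfl

theorem weylOp_zero (f : L2 d) : weylOp 0 f = f := by
  ext x
  simp [weylOp_apply, phase_zero]

theorem weylOp_weylOp (z w : E d × E d) (f : L2 d) :
    weylOp z (weylOp w f) = phase ⟪w.1, z.2⟫_ℝ • weylOp (z + w) f := by
  ext x
  have h : phase (-⟪w.1, x - z.2⟫_ℝ) = phase (-⟪w.1, x⟫_ℝ) * phase ⟪w.1, z.2⟫_ℝ := by
    rw [← phase_add, inner_sub_right]
    congr 1
    ring
  rw [weylOp_apply, weylOp_apply, lp.coeFn_smul, Pi.smul_apply, weylOp_apply, h, Prod.fst_add,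
    inner_add_left, neg_add, phase_add, Prod.snd_add, smul_eq_mul, sub_sub]
  ring

theorem star_weylOp (z : E d × E d) :
    star (weylOp z).toContinuousLinearMap =
      phase ⟪z.1, z.2⟫_ℝ • (weylOp (-z)).toContinuousLinearMap := by
  symm
  rw [ContinuousLinearMap.star_eq_adjoint, ContinuousLinearMap.eq_adjoint_iff]
  intro f g
  rw [← (weylOp z).inner_map_map]
  congr 1
  simp only [smul_apply, LinearIsometry.coe_toContinuousLinearMap, map_smul,
    weylOp_weylOp, add_neg_cancel, weylOp_zero, smul_smul, ← phase_add]
  simp [phase_zero]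

/-- The linear extension of `mono z c ↦ c • weylOp z`. -/
def regularMap (d : ℕ) : PreAlg d →ₗ[ℂ] (L2 d →L[ℂ] L2 d) :=
  Finsupp.linearCombination ℂ fun z : E d × E d => (weylOp z).toContinuousLinearMap

theorem regularMap_mono (z : E d × E d) (c : ℂ) :
    regularMap d (mono z c) = c • (weylOp z).toContinuousLinearMap :=
  Finsupp.linearCombination_single ℂ c z

theorem regularMap_mul (a b : PreAlg d) :
    regularMap d (a * b) = regularMap d a * regularMap d b := by
  induction a using PreAlg.induct with
  | h0 => simp
  | hadd a a' h1 h2 => simp only [add_mul, map_add, h1, h2]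
  | hm z c =>
    induction b using PreAlg.induct with
    | h0 => simp
    | hadd a a' h1 h2 => simp only [mul_add, map_add, h1, h2]
    | hm w c' =>
      ext1 f
      simp only [PreAlg.mono_mul_mono, regularMap_mono, smul_apply,
        mul_apply_eq_comp, LinearIsometry.coe_toContinuousLinearMap, map_smul,
        weylOp_weylOp, smul_smul]
      congr 1
      ring

theorem regularMap_star (a : PreAlg d) : regularMap d (star a) = star (regularMap d a) := by
  induction a using PreAlg.induct with
  | h0 => simp
  | hadd a a' h1 h2 => simp only [star_add, map_add, h1, h2]
  | hm z c =>
    simp only [PreAlg.star_mono, regularMap_mono, star_smul, star_weylOp, smul_smul]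

/-- The representation of the Weyl algebra on square summable functions. -/
def regularRep (d : ℕ) : PreAlg.Rep d where
  H := L2 d
  toHom :=
    { regularMap d with
      map_zero' := map_zero (regularMap d)
      map_mul' := regularMap_mul
      map_star' := regularMap_star }

/-- The norm is a supremum over representations and would vanish if all of them did. The
representation on `L2 d` sends `1` to the identity, which does not kill the point mass at `0`. -/
instance : Nontrivial (Alg d) := by
  refine ⟨1, 0, fun h => ?_⟩
  have h1 : ‖(1 : PreAlg d)‖ = 0 := by
    rw [← Alg.norm_of]
    exact (congrArg norm h).trans norm_zero
  have h2 := ((regularRep d).norm_le 1).trans h1.le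
  have h3 : regularMap d 1 = 0 :=
    norm_le_zero_iff (E := L2 d →L[ℂ] L2 d) (a := regularMap d 1) |>.1 h2
  have h4 : weylOp (0 : E d × E d) (lp.single 2 0 1) = 0 := by
    have := congrArg (fun T => T (lp.single 2 (0 : E d) (1 : ℂ))) h3
    simpa [PreAlg.one_def, regularMap_mono] using this
  rw [weylOp_zero] at h4
  have h5 := congrArg (fun f : L2 d => f 0) h4
  simp at h5

end RegularRepresentation

/-! ### States of a unital C*-algebra and their values at unitaries -/

section States

variable {A : Type*} [CStarAlgebra A]

theorem nonneg_im {c : ℂ} (h : 0 ≤ c) : c.im = 0 := (Complex.nonneg_iff.1 h).2.symm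

/-- By the C*-identity one may expand the square, and self-adjointness of `h` makes the cross terms
cancel. -/
theorem norm_add_I_smul_sq_le {h : A} (hh : IsSelfAdjoint h) (s : ℝ) :
    ‖h + algebraMap ℂ A (s * Complex.I)‖ ^ 2 ≤ ‖h‖ ^ 2 + s ^ 2 * ‖(1 : A)‖ := by
  have h1 : star (h + algebraMap ℂ A (s * Complex.I)) * (h + algebraMap ℂ A (s * Complex.I)) =
      h * h + ((s : ℂ) ^ 2) • (1 : A) := by
    simp only [Algebra.algebraMap_eq_smul_one, star_add, star_smul, star_one, hh.star_eq, add_mul,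
      mul_add, smul_mul_assoc, mul_smul_comm, one_mul, mul_one, star_mul',
      Complex.star_def, Complex.conj_I, Complex.conj_ofReal]
    have h2 : (s : ℂ) * Complex.I * (s * -Complex.I) = s ^ 2 := by
      linear_combination -(s : ℂ) ^ 2 * Complex.I_sq
    rw [smul_add, smul_smul, h2]
    module
  rw [sq, ← CStarRing.norm_star_mul_self, h1]
  refine (norm_add_le _ _).trans (add_le_add ?_ ?_)
  · rw [sq]
    exact norm_mul_le _ _
  · rw [norm_smul, norm_pow, Complex.norm_real, Real.norm_eq_abs, sq_abs]

/-- A contractive normalized functional is a state. -/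
theorem mem_stateSpace_of_norm_le [Nontrivial A] {φ : WeakDual ℂ A} (h1 : φ 1 = 1)
    (hφ : ∀ a, ‖φ a‖ ≤ ‖a‖) : φ ∈ stateSpace A := by
  refine ⟨fun a => ?_, h1⟩
  have hsa : IsSelfAdjoint (star a * a) := IsSelfAdjoint.star_mul_self a
  generalize hh : star a * a = h at *
  have halg (c : ℂ) : φ (algebraMap ℂ A c) = c := by
    rw [Algebra.algebraMap_eq_smul_one, map_smul, h1, smul_eq_mul, mul_one]
  rw [Complex.nonneg_iff]
  constructor
  -- Positivity of `h` amounts to `‖‖h‖ - h‖ ≤ ‖h‖`. Applying the contraction `φ` gives `‖h‖ - Re φ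
  -- h ≤ ‖h‖`.
  · have h2 : SpectrumRestricts h ContinuousMap.realToNNReal := by
      rw [SpectrumRestricts.nnreal_iff, ← hh]
      exact spectrum_star_mul_self_nonneg
    rw [SpectrumRestricts.nnreal_iff_nnnorm hsa le_rfl] at h2
    have h3 := (hφ _).trans (NNReal.coe_le_coe.2 h2)
    rw [IsScalarTower.algebraMap_apply ℝ ℂ A, map_sub, halg] at h3
    have h4 := (Complex.re_le_norm _).trans h3
    simp at h4
    exact h4
  · by_contra hne
    have key (s : ℝ) : ((φ h).im + s) ^ 2 ≤ ‖h‖ ^ 2 + s ^ 2 := by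
      have h2 := norm_add_I_smul_sq_le hsa s
      rw [CStarRing.norm_one, mul_one] at h2
      have h3 : ‖φ (h + algebraMap ℂ A (s * Complex.I))‖ ^ 2 ≤ ‖h‖ ^ 2 + s ^ 2 :=
        (pow_le_pow_left₀ (norm_nonneg _) (hφ _) 2).trans h2
      rw [map_add, halg] at h3
      have h4 := pow_le_pow_left₀ (abs_nonneg _)
        (Complex.abs_im_le_norm (φ h + (s * Complex.I))) 2
      rw [sq_abs] at h4
      simpa using h4.trans h3
    -- After cancelling `s ^ 2`, the bound in `key` is affine in `s` with slope `2 * (φ h).im`. This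
    -- `s` makes the linear term `‖h‖ ^ 2 + 1`, more than the right side allows.
    have h5 := key ((‖h‖ ^ 2 + 1) / (2 * (φ h).im))
    have h6 : 2 * (φ h).im * ((‖h‖ ^ 2 + 1) / (2 * (φ h).im)) = ‖h‖ ^ 2 + 1 := by
      have : (φ h).im ≠ 0 := fun h => hne h.symm
      field_simp
    nlinarith [sq_nonneg (φ h).im]

variable {φ : WeakDual ℂ A}

theorem state_expand (φ : WeakDual ℂ A) (a b : A) (t : ℂ) :
    φ (star (a + t • b) * (a + t • b)) =
      φ (star a * a) + t * φ (star a * b) + star t * φ (star b * a) +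
        star t * t * φ (star b * b) := by
  simp only [star_add, star_smul, add_mul, mul_add, map_add, smul_mul_assoc, mul_smul_comm,
    map_smul, smul_eq_mul]
  ring

/-- Polarization: the values at `a + b` and `a + I • b` are real, which fixes the imaginary and the
real part respectively. -/
theorem state_star_mul (hφ : φ ∈ stateSpace A) (a b : A) :
    φ (star b * a) = star (φ (star a * b)) := by
  have ha := nonneg_im (hφ.1 a)
  have hb := nonneg_im (hφ.1 b)
  have h1 := nonneg_im (hφ.1 (a + (1 : ℂ) • b))
  have h2 := nonneg_im (hφ.1 (a + Complex.I • b))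
  rw [state_expand] at h1 h2
  simp [ha, hb] at h1 h2
  refine Complex.ext ?_ ?_
  · simp
    linarith
  · simp
    linarith

theorem state_star (hφ : φ ∈ stateSpace A) (a : A) : φ (star a) = star (φ a) := by
  simpa using state_star_mul hφ 1 a

/-- The kernel of a state in the sense of the Gelfand-Naimark-Segal construction. -/
theorem state_star_mul_eq_zero (hφ : φ ∈ stateSpace A) {b : A} (hb : φ (star b * b) = 0) (a : A) :
    φ (star a * b) = 0 := by
  by_contra hne
  set c := φ (star a * b) with hc
  have h0 : 0 < ‖c‖ ^ 2 := by positivity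
  -- With no quadratic term, moving from `a` along `b` changes the value linearly; this `r` brings
  -- it down to `-1`, against positivity.
  obtain ⟨r, hr⟩ : ∃ r : ℝ, (φ (star a * a)).re + 1 = 2 * r * ‖c‖ ^ 2 :=
    ⟨((φ (star a * a)).re + 1) / (2 * ‖c‖ ^ 2), by field_simp⟩
  have h1 := (Complex.nonneg_iff.1 (hφ.1 (a + (-(r : ℂ) * star c) • b))).1
  rw [state_expand, hb, state_star_mul hφ a b, ← hc] at h1
  have h2 : φ (star a * a) + -(r : ℂ) * star c * c + star (-(r : ℂ) * star c) * star c +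
      star (-(r : ℂ) * star c) * (-(r : ℂ) * star c) * 0 =
      φ (star a * a) - ((2 * r * ‖c‖ ^ 2 : ℝ) : ℂ) := by
    have h3 : star c * c = ((‖c‖ ^ 2 : ℝ) : ℂ) := by
      rw [Complex.star_def, Complex.conj_mul']
      push_cast
      rfl
    have h4 : star (-(r : ℂ) * star c) = -(r : ℂ) * c := by
      simp
    rw [h4]
    push_cast at h3 ⊢
    linear_combination (-2 * (r : ℂ)) * h3
  rw [h2, Complex.sub_re, Complex.ofReal_re, ← hr] at h1
  linarith

/-- Positivity at `1 - star (φ w) • w` gives `0 ≤ 1 - ‖φ w‖ ^ 2`. -/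
theorem norm_state_le_one (hφ : φ ∈ stateSpace A) {w : A} (hw : star w * w = 1) :
    ‖φ w‖ ≤ 1 := by
  have h1 := (Complex.nonneg_iff.1 (hφ.1 (1 + (-star (φ w)) • w))).1
  have h3 : star (φ w) * φ w = ((‖φ w‖ ^ 2 : ℝ) : ℂ) := by
    rw [Complex.star_def, Complex.conj_mul']
    push_cast
    rfl
  have h2 : φ (star (1 + (-star (φ w)) • w) * (1 + (-star (φ w)) • w)) =
      ((1 - ‖φ w‖ ^ 2 : ℝ) : ℂ) := by
    rw [state_expand, hw, star_one, one_mul, one_mul, mul_one, hφ.2, state_star hφ, star_neg,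
      star_star]
    push_cast at h3 ⊢
    linear_combination -h3
  rw [h2, Complex.ofReal_re] at h1
  nlinarith [norm_nonneg (φ w)]

/-- A state that has modulus one at a unitary is multiplicative there. -/
theorem state_mul_unitary (hφ : φ ∈ stateSpace A) {w : A} (hw : star w * w = 1)
    (h : ‖φ w‖ = 1) (a : A) : φ (a * w) = φ a * φ w := by
  have h3 : star (φ w) * φ w = 1 := by
    rw [Complex.star_def, Complex.conj_mul', h]
    simp
  -- The variance of `w` is `1 - ‖φ w‖ ^ 2 = 0`, so `w - φ w • 1` lies in the GNS kernel.
  have h1 : φ (star (w + (-φ w) • 1) * (w + (-φ w) • 1)) = 0 := by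
    rw [state_expand, hw, star_one, one_mul, one_mul, mul_one, hφ.2, state_star hφ, star_neg]
    linear_combination -h3
  have h2 := state_star_mul_eq_zero hφ h1 (star a)
  rw [star_star, mul_add, map_add, mul_smul_comm, map_smul, mul_one, smul_eq_mul] at h2
  linear_combination h2

theorem state_unitary_mul (hφ : φ ∈ stateSpace A) {w : A} (hw : w * star w = 1)
    (h : ‖φ w‖ = 1) (a : A) : φ (w * a) = φ w * φ a := by
  have h1 := state_mul_unitary hφ (w := star w) (by rw [star_star, hw])
    (by rw [state_star hφ, norm_star, h]) (star a)
  rw [← star_mul, state_star hφ, state_star hφ, state_star hφ, ← star_mul'] at h1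
  have h2 := star_injective h1
  rw [h2, mul_comm]

/-- Points of the unit circle are extreme in the disc; multiplying by `star c` reduces to `c = 1`,
where real parts decide. -/
theorem eq_of_convex_combination {c c₁ c₂ : ℂ} {s t : ℝ} (hs : 0 < s) (ht : 0 < t)
    (hst : s + t = 1) (hc : ‖c‖ = 1) (h₁ : ‖c₁‖ ≤ 1) (h₂ : ‖c₂‖ ≤ 1)
    (h : (s : ℂ) * c₁ + t * c₂ = c) : c₁ = c := by
  have hcc : star c * c = 1 := by
    rw [Complex.star_def, Complex.conj_mul', hc]
    simp
  have hn (x : ℂ) : ‖star c * x‖ = ‖x‖ := by rw [norm_mul, norm_star, hc, one_mul]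
  have h3 : (s : ℂ) * (star c * c₁) + t * (star c * c₂) = 1 := by
    linear_combination star c * h + hcc
  have h4 : ‖star c * c₁‖ ≤ 1 := (hn _).trans_le h₁
  have h5 : (star c * c₂).re ≤ 1 := (Complex.re_le_norm _).trans ((hn _).trans_le h₂)
  have h6 := congrArg Complex.re h3
  simp only [Complex.add_re, Complex.re_ofReal_mul, Complex.one_re] at h6
  have h7 : 1 ≤ (star c * c₁).re := by nlinarith
  have h8 : (star c * c₁).re ^ 2 + (star c * c₁).im ^ 2 ≤ 1 := by
    have := Complex.sq_norm (star c * c₁)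
    rw [Complex.normSq_apply] at this
    nlinarith [norm_nonneg (star c * c₁)]
  have h9 : star c * c₁ = 1 := Complex.ext (by rw [Complex.one_re]; nlinarith)
    (by rw [Complex.one_im]; nlinarith)
  linear_combination c * h9 - c₁ * hcc

end States

/-! ### Weyl monomials, Zak invariance and the commutative subalgebra -/

section WeylElements

variable {d : ℕ}

/-- The monomial `u_α v_β` at `(α, β)`. -/
def weyl (z : E d × E d) : Alg d := Alg.of (mono z 1)

theorem weyl_zero : weyl (0 : E d × E d) = 1 := rfl

theorem weyl_mul (z w : E d × E d) : weyl z * weyl w = phase ⟪w.1, z.2⟫_ℝ • weyl (z + w) := by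
  rw [weyl, weyl, ← Alg.of_mul, PreAlg.mono_mul_mono, weyl, ← Alg.of_smul, PreAlg.smul_mono]
  simp

theorem star_weyl (z : E d × E d) : star (weyl z) = phase ⟪z.1, z.2⟫_ℝ • weyl (-z) := by
  rw [weyl, ← Alg.of_star, PreAlg.star_mono, weyl, ← Alg.of_smul, PreAlg.smul_mono]
  simp

theorem star_weyl_mul_weyl (z : E d × E d) : star (weyl z) * weyl z = 1 := by
  rw [weyl, ← Alg.of_star, ← Alg.of_mul, PreAlg.star_mono_mul_mono]
  rfl

theorem weyl_mul_star_weyl (z : E d × E d) : weyl z * star (weyl z) = 1 := by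
  rw [star_weyl, mul_smul_comm, weyl_mul, smul_smul, ← phase_add, add_neg_cancel, weyl_zero]
  simp [phase_zero]

theorem norm_weyl (z : E d × E d) : ‖weyl z‖ = 1 := by
  have h := CStarRing.norm_star_mul_self (x := weyl z)
  rw [star_weyl_mul_weyl, CStarRing.norm_one] at h
  nlinarith [norm_nonneg (weyl z)]

theorem weyl_comm (z w : E d × E d) :
    weyl w * weyl z = phase (⟪z.1, w.2⟫_ℝ - ⟪w.1, z.2⟫_ℝ) • (weyl z * weyl w) := by
  rw [weyl_mul, weyl_mul, smul_smul, ← phase_add, sub_add_cancel, add_comm]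

/-- Used twice: with `w` in the lattice it forces Zak states to vanish off `Γ' × Γ`, with `w`
arbitrary it moves one Zak state to another. -/
theorem weyl_conj (z w : E d × E d) :
    weyl w * weyl z * star (weyl w) = phase (⟪z.1, w.2⟫_ℝ - ⟪w.1, z.2⟫_ℝ) • weyl z := by
  rw [weyl_comm, smul_mul_assoc, mul_assoc, weyl_mul_star_weyl, mul_one]

theorem u_mul_v (α β : E d) : Alg.u α * Alg.v β = weyl (α, β) := by
  have h := weyl_mul (α, (0 : E d)) (0, β)
  rw [inner_zero_right, phase_zero, one_smul, Prod.mk_add_mk, add_zero, zero_add] at h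
  exact h

theorem v_mul_u (α β : E d) : Alg.v β * Alg.u α = phase ⟪α, β⟫_ℝ • weyl (α, β) := by
  have h := weyl_mul ((0 : E d), β) (α, 0)
  rw [Prod.mk_add_mk, add_zero, zero_add] at h
  exact h

/-- Continuous functionals agreeing on monomials are equal. -/
theorem weakDual_ext {φ ψ : WeakDual ℂ (Alg d)} (h : ∀ z, φ (weyl z) = ψ (weyl z)) : φ = ψ := by
  refine ContinuousLinearMap.ext fun a => ?_
  induction a using Alg.induct with
  | hp => exact isClosed_eq φ.cont ψ.cont
  | h a =>
    induction a using PreAlg.induct with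
    | h0 => exact (map_zero φ).trans (map_zero ψ).symm
    | hadd a b h1 h2 =>
      rw [Alg.of_add]
      exact (map_add φ _ _).trans ((congrArg₂ _ h1 h2).trans (map_add ψ _ _).symm)
    | hm z c =>
      have h1 : Alg.of (mono z c) = c • weyl z := by
        rw [weyl, ← Alg.of_smul, PreAlg.smul_mono, mul_one]
      rw [h1]
      exact (map_smul φ _ _).trans ((congrArg _ (h z)).trans (map_smul ψ _ _).symm)

variable (e : Module.Basis (Fin d) ℝ (E d))

theorem weyl_mul_of_mem {z w : E d × E d} (hz : z ∈ phaseLattice e) (hw : w ∈ phaseLattice e) :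
    weyl z * weyl w = weyl (z + w) := by
  rw [weyl_mul, phase_inner_of_mem e hw.1 hz.2, one_smul]

theorem star_weyl_of_mem {z : E d × E d} (hz : z ∈ phaseLattice e) :
    star (weyl z) = weyl (-z) := by
  rw [star_weyl, phase_inner_of_mem e hz.1 hz.2, one_smul]

/-- For `γ ∈ Γ` and `γ' ∈ Γ'` the commutation phase is trivial, so the two successive translations
are conjugation by a single monomial. -/
theorem mem_zakStates_iff {φ : WeakDual ℂ (Alg d)} :
    φ ∈ zakStates e ↔ φ ∈ stateSpace (Alg d) ∧
      ∀ l ∈ phaseLattice e, ∀ a, φ (weyl l * a * star (weyl l)) = φ a := by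
  have key {γ γ' : E d} (hγ : γ ∈ lattice e) (hγ' : γ' ∈ dualLattice e) (a : Alg d) :
      Alg.tau γ (Alg.theta γ' a) = weyl (γ', γ) * a * star (weyl (γ', γ)) := by
    have h := v_mul_u γ' γ
    rw [phase_inner_of_mem e hγ' hγ, one_smul] at h
    rw [Alg.tau, Alg.theta, ← h, star_mul]
    simp only [mul_assoc]
  refine and_congr_right fun _ => ⟨fun h l hl a => ?_, fun h γ hγ γ' hγ' a => ?_⟩
  · rw [← h l.2 hl.2 l.1 hl.1 a, key hl.2 hl.1]
  · rw [key hγ hγ', h _ ⟨hγ', hγ⟩]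

theorem zakState_weyl_eq_zero {φ : WeakDual ℂ (Alg d)} (hφ : φ ∈ zakStates e) {z : E d × E d}
    (hz : z ∉ phaseLattice e) : φ (weyl z) = 0 := by
  obtain ⟨l, hl, hne⟩ := exists_chi_ne_one e hz
  have h := ((mem_zakStates_iff e).1 hφ).2 l hl (weyl z)
  rw [weyl_conj, map_smul, smul_eq_mul] at h
  have h1 : (phase (⟪z.1, l.2⟫_ℝ - ⟪l.1, z.2⟫_ℝ) - 1) * φ (weyl z) = 0 := by
    linear_combination h
  exact (mul_eq_zero.1 h1).resolve_left (sub_ne_zero.2 hne)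

variable {e} in
-- A lattice monomial and its adjoint factor out of `φ`, and their values multiply to `1`.
theorem mem_zakStates_of_chi {φ : WeakDual ℂ (Alg d)} (hφ : φ ∈ stateSpace (Alg d))
    (h : ∀ l ∈ phaseLattice e, ‖φ (weyl l)‖ = 1) : φ ∈ zakStates e := by
  refine (mem_zakStates_iff e).2 ⟨hφ, fun l hl a => ?_⟩
  have h1 := h l hl
  have hs : ‖φ (star (weyl l))‖ = 1 := by rw [state_star hφ, norm_star, h1]
  rw [state_mul_unitary hφ (by rw [star_star, weyl_mul_star_weyl]) hs,
    state_unitary_mul hφ (weyl_mul_star_weyl l) h1, state_star hφ, Complex.star_def,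
    mul_right_comm, Complex.mul_conj', h1]
  simp

theorem zakState_ext {φ ψ : WeakDual ℂ (Alg d)} (hφ : φ ∈ zakStates e) (hψ : ψ ∈ zakStates e)
    (h : ∀ l ∈ phaseLattice e, φ (weyl l) = ψ (weyl l)) : φ = ψ := by
  refine weakDual_ext fun z => ?_
  by_cases hz : z ∈ phaseLattice e
  · exact h z hz
  · rw [zakState_weyl_eq_zero e hφ hz, zakState_weyl_eq_zero e hψ hz]

/-- In a convex decomposition into arbitrary states, extremality on the circle forces the components
to agree with `φ` at lattice monomials. They are then Zak states themselves, hence equal to `φ`. -/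
theorem mem_pureStates_of_chi {φ : WeakDual ℂ (Alg d)} (hφ : φ ∈ stateSpace (Alg d))
    (h : ∀ l ∈ phaseLattice e, ‖φ (weyl l)‖ = 1) : φ ∈ pureStates (Alg d) := by
  refine ⟨hφ, fun φ₁ h₁ φ₂ h₂ hmem => ?_⟩
  obtain ⟨s, t, hs, ht, hst, rfl⟩ := hmem
  have key (l) (hl : l ∈ phaseLattice e) : φ₁ (weyl l) = (s • φ₁ + t • φ₂) (weyl l) :=
    eq_of_convex_combination hs ht hst (h l hl) (norm_state_le_one h₁ (star_weyl_mul_weyl l))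
      (norm_state_le_one h₂ (star_weyl_mul_weyl l)) rfl
  exact zakState_ext e (mem_zakStates_of_chi h₁ fun l hl => by rw [key l hl, h l hl])
    (mem_zakStates_of_chi hφ h) key

/-- The commutative `C*`-algebra generated by the monomials of `Γ' × Γ`. -/
def zakAlg : StarSubalgebra ℂ (Alg d) :=
  (StarAlgebra.adjoin ℂ (weyl '' (phaseLattice e : Set (E d × E d)))).topologicalClosure

theorem isClosed_zakAlg : IsClosed (zakAlg e : Set (Alg d)) :=
  StarSubalgebra.isClosed_topologicalClosure _

theorem weyl_mem_zakAlg {l : E d × E d} (hl : l ∈ phaseLattice e) : weyl l ∈ zakAlg e :=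
  StarSubalgebra.le_topologicalClosure _ (StarAlgebra.subset_adjoin ℂ _ ⟨l, hl, rfl⟩)

theorem zakAlg_le {S : StarSubalgebra ℂ (Alg d)} (hS : IsClosed (S : Set (Alg d)))
    (h : ∀ l ∈ phaseLattice e, weyl l ∈ S) : zakAlg e ≤ S := by
  refine StarSubalgebra.topologicalClosure_minimal ?_ hS
  refine StarAlgebra.adjoin_le ?_
  rintro _ ⟨l, hl, rfl⟩
  exact h l hl

/-- The closed algebra generated by a commuting self-adjoint set lies in its double centralizer,
which is commutative. -/
theorem zakAlg_mul_comm {a b : Alg d} (ha : a ∈ zakAlg e) (hb : b ∈ zakAlg e) :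
    a * b = b * a := by
  set S := weyl '' (phaseLattice e : Set (E d × E d))
  have hstar : star S ⊆ S := by
    rintro x ⟨l, hl, hx⟩
    exact ⟨-l, neg_mem hl, by rw [← star_weyl_of_mem e hl, hx, star_star]⟩
  have hcomm : ∀ a ∈ S ∪ star S, ∀ b ∈ S ∪ star S, a * b = b * a := by
    rw [Set.union_eq_left.2 hstar]
    rintro _ ⟨l, hl, rfl⟩ _ ⟨m, hm, rfl⟩
    rw [weyl_mul_of_mem e hl hm, weyl_mul_of_mem e hm hl, add_comm]
  have hle := StarSubalgebra.topologicalClosure_adjoin_le_centralizer_centralizer ℂ S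
  have h1 := hle ha
  have h2 := hle hb
  rw [← SetLike.mem_coe, StarSubalgebra.coe_centralizer_centralizer] at h1 h2
  exact Set.centralizer_centralizer_comm_of_comm hcomm _ h1 _ h2

instance : CommCStarAlgebra (zakAlg e) :=
  haveI : IsClosed (zakAlg e : Set (Alg d)) := isClosed_zakAlg e
  { StarSubalgebra.cstarAlgebra (zakAlg e) with
    mul_comm := fun a b => Subtype.ext (zakAlg_mul_comm e a.2 b.2) }

end WeylElements

open WeakDual (characterSpace)

/-! ### Pure Zak states and the torus as character space -/

section ZakStates

variable {d : ℕ} (e : Module.Basis (Fin d) ℝ (E d))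

theorem norm_character_le (χ : characterSpace ℂ (zakAlg e)) (b : zakAlg e) : ‖χ b‖ ≤ ‖b‖ :=
  spectrum.norm_le_norm_of_mem (AlgHom.apply_mem_spectrum χ b)

/-- Hahn–Banach preserves the norm, and a contractive functional with value `1` at `1` is a state.
-/
theorem exists_state_extension (χ : characterSpace ℂ (zakAlg e)) :
    ∃ φ ∈ stateSpace (Alg d), (∀ a, ‖φ a‖ ≤ ‖a‖) ∧ ∀ b : zakAlg e, φ b = χ b := by
  let S : Submodule ℂ (Alg d) := Subalgebra.toSubmodule (zakAlg e).toSubalgebra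
  let f₀ : S →ₗ[ℂ] ℂ :=
    { toFun := fun b => χ ⟨b.1, b.2⟩
      map_add' := fun a b => map_add χ ⟨a.1, a.2⟩ ⟨b.1, b.2⟩
      map_smul' := fun c b => map_smul χ c ⟨b.1, b.2⟩ }
  have hf₀ (b : S) : ‖f₀ b‖ ≤ 1 * ‖b‖ := by
    rw [one_mul]
    exact norm_character_le e χ ⟨b.1, b.2⟩
  obtain ⟨g, hg, hnorm⟩ := exists_extension_norm_eq S (f₀.mkContinuous 1 hf₀)
  have hg1 : ‖g‖ ≤ 1 := hnorm.trans_le (LinearMap.mkContinuous_norm_le _ zero_le_one _)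
  have hle (a : Alg d) : ‖g a‖ ≤ ‖a‖ := by
    simpa using g.le_of_opNorm_le hg1 a
  have hχ (b : zakAlg e) : g b = χ b := hg ⟨b.1, b.2⟩
  refine ⟨StrongDual.toWeakDual g, mem_stateSpace_of_norm_le ?_ hle, hle, hχ⟩
  exact (hχ 1).trans (map_one χ)

/-- The restriction to lattice monomials is a group homomorphism; it is unimodular since its values
at `l` and `-l` are conjugate with product `1`. -/
theorem exists_eq_chi_of_character (χ : characterSpace ℂ (zakAlg e)) :
    ∃ κ ν : E d, ∀ l (hl : l ∈ phaseLattice e), χ ⟨weyl l, weyl_mem_zakAlg e hl⟩ = chi κ ν l := by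
  obtain ⟨φ, hφ, hle, hχ⟩ := exists_state_extension e χ
  have h1 (l) (hl : l ∈ phaseLattice e) := hχ ⟨weyl l, weyl_mem_zakAlg e hl⟩
  have hmul (x) (hx : x ∈ phaseLattice e) (y) (hy : y ∈ phaseLattice e) :
      φ (weyl (x + y)) = φ (weyl x) * φ (weyl y) := by
    rw [h1 x hx, h1 y hy, ← map_mul, h1 _ (add_mem hx hy)]
    congr 1
    exact Subtype.ext (weyl_mul_of_mem e hx hy).symm
  obtain ⟨κ, ν, h⟩ := exists_eq_chi e (χ := fun l => φ (weyl l)) hmul fun l hl => by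
    have h2 : ‖φ (star (weyl l))‖ * ‖φ (weyl l)‖ = 1 := by
      rw [star_weyl_of_mem e hl, ← norm_mul, ← hmul _ (neg_mem hl) _ hl, neg_add_cancel, weyl_zero,
        hφ.2, norm_one]
    rw [state_star hφ, norm_star] at h2
    nlinarith [norm_nonneg (φ (weyl l))]
  exact ⟨κ, ν, fun l hl => (h1 l hl).symm.trans (h l hl)⟩

theorem exists_chi_state (κ ν : E d) :
    ∃ φ ∈ stateSpace (Alg d), (∀ a, ‖φ a‖ ≤ ‖a‖) ∧
      ∀ l ∈ phaseLattice e, φ (weyl l) = chi κ ν l := by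
  obtain ⟨χ⟩ : Nonempty (characterSpace ℂ (zakAlg e)) := inferInstance
  obtain ⟨φ, hφ, hle, hχ⟩ := exists_state_extension e χ
  obtain ⟨κ₀, ν₀, h⟩ := exists_eq_chi_of_character e χ
  -- By `weyl_conj`, conjugation by this monomial contributes exactly the phase that turns `chi κ₀
  -- ν₀` into `chi κ ν`.
  let w : E d × E d := (κ₀ - κ, ν - ν₀)
  let g : Alg d →L[ℂ] ℂ := (WeakDual.toStrongDual φ).comp
    (ContinuousLinearMap.mulLeftRight ℂ (Alg d) (weyl w) (star (weyl w)))
  have hg (a : Alg d) : g a = φ (weyl w * a * star (weyl w)) := rfl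
  have hgle (a : Alg d) : ‖g a‖ ≤ ‖a‖ := by
    rw [hg]
    refine (hle _).trans ((norm_mul_le _ _).trans ?_)
    rw [norm_star, norm_weyl, mul_one]
    refine (norm_mul_le _ _).trans ?_
    rw [norm_weyl, one_mul]
  refine ⟨StrongDual.toWeakDual g, mem_stateSpace_of_norm_le ?_ hgle, hgle, fun l hl => ?_⟩
  · refine (hg 1).trans ?_
    rw [mul_one, weyl_mul_star_weyl, hφ.2]
  · refine (hg _).trans ?_
    rw [weyl_conj, map_smul, hχ ⟨weyl l, weyl_mem_zakAlg e hl⟩, h l hl]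
    simp only [chi, smul_eq_mul, w]
    rw [← phase_add, ← phase_add, ← phase_add]
    congr 1
    rw [inner_sub_left, inner_sub_right]
    ring

/-- The Zak state at a point of the torus. -/
def zakState (p : Torus e) : WeakDual ℂ (Alg d) :=
  (exists_chi_state e (Torus.mk_surjective e p).choose
    (Torus.mk_surjective e p).choose_spec.choose).choose

theorem zakState_mem_stateSpace (p : Torus e) : zakState e p ∈ stateSpace (Alg d) :=
  (exists_chi_state e _ _).choose_spec.1

theorem norm_zakState_le (p : Torus e) (a : Alg d) : ‖zakState e p a‖ ≤ ‖a‖ :=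
  (exists_chi_state e _ _).choose_spec.2.1 a

/-- The definition chooses some representatives of the point; on `Γ' × Γ` the character does not
depend on them. -/
theorem zakState_mk (κ ν : E d) {l : E d × E d} (hl : l ∈ phaseLattice e) :
    zakState e (Torus.mk e κ ν) (weyl l) = chi κ ν l := by
  have h := (Torus.mk_surjective e (Torus.mk e κ ν)).choose_spec.choose_spec
  rw [← (Torus.mk_eq_iff e).1 h l hl]
  exact (exists_chi_state e _ _).choose_spec.2.2 l hl

theorem norm_zakState_weyl (p : Torus e) {l : E d × E d} (hl : l ∈ phaseLattice e) :
    ‖zakState e p (weyl l)‖ = 1 := by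
  obtain ⟨κ, ν, rfl⟩ := Torus.mk_surjective e p
  rw [zakState_mk e κ ν hl, norm_chi]

theorem zakState_mem_zakStates (p : Torus e) : zakState e p ∈ zakStates e :=
  mem_zakStates_of_chi (zakState_mem_stateSpace e p) fun _ hl => norm_zakState_weyl e p hl

theorem zakState_mem_pureZakStates (p : Torus e) : zakState e p ∈ pureZakStates e :=
  ⟨zakState_mem_zakStates e p,
    mem_pureStates_of_chi e (zakState_mem_stateSpace e p) fun _ hl => norm_zakState_weyl e p hl⟩

theorem continuous_zakState_weyl (z : E d × E d) :
    Continuous fun p => zakState e p (weyl z) := by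
  by_cases hz : z ∈ phaseLattice e
  · have hq : Topology.IsQuotientMap fun x : E d × E d => Torus.mk e x.1 x.2 :=
      (QuotientAddGroup.isOpenQuotientMap_mk.prodMap
        QuotientAddGroup.isOpenQuotientMap_mk).isQuotientMap
    rw [hq.continuous_iff]
    simp only [Function.comp_def, zakState_mk e _ _ hz, chi]
    exact (continuous_phase.comp (by fun_prop)).mul (continuous_phase.comp (by fun_prop))
  · simp only [zakState_weyl_eq_zero e (zakState_mem_zakStates e _) hz]
    exact continuous_const

/-- Since all these states are contractive, approximating `a` from the dense subalgebra is uniform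
in `p`. -/
theorem continuous_zakState_apply (a : Alg d) : Continuous fun p => zakState e p a := by
  have key (b : PreAlg d) : Continuous fun p => zakState e p (Alg.of b) := by
    induction b using PreAlg.induct with
    | h0 =>
      have h (p : Torus e) : zakState e p (Alg.of 0) = 0 := map_zero (zakState e p)
      simp only [h]
      exact continuous_const
    | hadd a b h1 h2 =>
      simp only [Alg.of_add, map_add]
      exact h1.add h2
    | hm z c =>
      have h1 : Alg.of (mono z c) = c • weyl z := by
        rw [weyl, ← Alg.of_smul, PreAlg.smul_mono, mul_one]
      simp only [h1, map_smul]
      exact (continuous_zakState_weyl e z).const_smul c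
  refine continuous_of_uniform_approx_of_continuous fun u hu => ?_
  obtain ⟨ε, hε, hεu⟩ := Metric.mem_uniformity_dist.1 hu
  obtain ⟨b, hb⟩ := Alg.denseRange_of.exists_dist_lt a hε
  refine ⟨_, key b, fun p => hεu ?_⟩
  rw [dist_eq_norm, ← map_sub]
  refine (norm_zakState_le e p _).trans_lt ?_
  rwa [← dist_eq_norm]

/-- A state that has modulus one at the monomials of `Γ' × Γ` is multiplicative at the elements of
the algebra that they generate. -/
theorem state_mul_of_mem_zakAlg {φ : WeakDual ℂ (Alg d)} (hφ : φ ∈ stateSpace (Alg d))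
    (h : ∀ l ∈ phaseLattice e, ‖φ (weyl l)‖ = 1) {b : Alg d} (hb : b ∈ zakAlg e) (a : Alg d) :
    φ (a * b) = φ a * φ b := by
  have halg (c : ℂ) : φ (algebraMap ℂ (Alg d) c) = c := by
    rw [Algebra.algebraMap_eq_smul_one, map_smul, hφ.2, smul_eq_mul, mul_one]
  -- The multiplicative domain of `φ`; it is taken two-sided because the involution swaps left and
  -- right.
  let S : StarSubalgebra ℂ (Alg d) :=
    { carrier := {b | ∀ a, φ (a * b) = φ a * φ b ∧ φ (b * a) = φ b * φ a}
      mul_mem' := fun {b c} hb hc a => by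
        constructor
        · rw [← mul_assoc, (hc _).1, (hb _).1, (hb _).2, mul_assoc]
        · rw [mul_assoc, (hb _).2, (hc _).2, (hb _).2, mul_assoc]
      add_mem' := fun {b c} hb hc a => by
        constructor
        · rw [mul_add, map_add, map_add, (hb a).1, (hc a).1, mul_add]
        · rw [add_mul, map_add, map_add, (hb a).2, (hc a).2, add_mul]
      algebraMap_mem' := fun c a => by
        constructor
        · rw [halg, ← Algebra.commutes, Algebra.algebraMap_eq_smul_one, smul_mul_assoc, one_mul,
            map_smul, smul_eq_mul, mul_comm]
        · rw [halg, Algebra.algebraMap_eq_smul_one, smul_mul_assoc, one_mul, map_smul, smul_eq_mul]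
      star_mem' := fun {b} hb a => by
        constructor
        · rw [← star_star (a * star b), star_mul, star_star, state_star hφ, (hb _).2,
            state_star hφ a, state_star hφ b, star_mul', star_star, mul_comm]
        · rw [← star_star (star b * a), star_mul, star_star, state_star hφ, (hb _).1,
            state_star hφ a, state_star hφ b, star_mul', star_star, mul_comm] }
  have hS : IsClosed (S : Set (Alg d)) := by
    have : (S : Set (Alg d)) =
        ⋂ a, {b | φ (a * b) = φ a * φ b} ∩ {b | φ (b * a) = φ b * φ a} := by
      ext b
      simp [S]
    rw [this]
    have hc : Continuous φ := φ.cont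
    exact isClosed_iInter fun a => (isClosed_eq (by fun_prop) (by fun_prop)).inter
      (isClosed_eq (by fun_prop) (by fun_prop))
  have hle := zakAlg_le e hS fun l hl a =>
    ⟨state_mul_unitary hφ (star_weyl_mul_weyl l) (h l hl) a,
      state_unitary_mul hφ (weyl_mul_star_weyl l) (h l hl) a⟩
  exact (hle hb a).1

/-- The character of `zakAlg e` at a point of the torus. -/
def zakCharacter (p : Torus e) : characterSpace ℂ (zakAlg e) :=
  WeakDual.CharacterSpace.equivAlgHom.symm
    { toFun := fun b => zakState e p b
      map_one' := (zakState_mem_stateSpace e p).2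
      map_mul' := fun a b => state_mul_of_mem_zakAlg e (zakState_mem_stateSpace e p)
        (fun _ hl => norm_zakState_weyl e p hl) b.2 a
      map_zero' := map_zero (zakState e p)
      map_add' := fun a b => map_add (zakState e p) (a : Alg d) (b : Alg d)
      commutes' := fun c => by
        change zakState e p (algebraMap ℂ (Alg d) c) = c
        rw [Algebra.algebraMap_eq_smul_one, map_smul, (zakState_mem_stateSpace e p).2, smul_eq_mul,
          mul_one] }

theorem zakCharacter_apply (p : Torus e) (b : zakAlg e) :
    zakCharacter e p b = zakState e p (b : Alg d) := rfl

theorem continuous_zakCharacter : Continuous (zakCharacter e) := by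
  refine Continuous.subtype_mk (WeakDual.continuous_of_continuous_eval fun b => ?_) _
  exact continuous_zakState_apply e b

theorem zakCharacter_injective : Function.Injective (zakCharacter e) := by
  intro p q h
  obtain ⟨κ, ν, rfl⟩ := Torus.mk_surjective e p
  obtain ⟨κ', ν', rfl⟩ := Torus.mk_surjective e q
  refine (Torus.mk_eq_iff e).2 fun l hl => ?_
  have h1 := congrArg (fun χ => χ ⟨weyl l, weyl_mem_zakAlg e hl⟩) h
  simp only [zakCharacter_apply] at h1
  rwa [zakState_mk e κ ν hl, zakState_mk e κ' ν' hl] at h1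

/-- The Hahn–Banach extension of a character is itself a Zak state, so it coincides with the one at
`(κ, ν)`. -/
theorem zakCharacter_surjective : Function.Surjective (zakCharacter e) := by
  intro χ
  obtain ⟨φ, hφ, -, hχ⟩ := exists_state_extension e χ
  obtain ⟨κ, ν, h⟩ := exists_eq_chi_of_character e χ
  have h1 (l) (hl : l ∈ phaseLattice e) : φ (weyl l) = chi κ ν l :=
    (hχ ⟨weyl l, weyl_mem_zakAlg e hl⟩).trans (h l hl)
  have h2 : zakState e (Torus.mk e κ ν) = φ :=
    zakState_ext e (zakState_mem_zakStates e _)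
      (mem_zakStates_of_chi hφ fun l hl => by rw [h1 l hl, norm_chi])
      fun l hl => by rw [zakState_mk e κ ν hl, h1 l hl]
  refine ⟨Torus.mk e κ ν, DFunLike.ext _ _ fun b => ?_⟩
  rw [zakCharacter_apply, h2, hχ]

/-- The torus is the character space of `zakAlg e`. -/
def torusHomeomorph : Torus e ≃ₜ characterSpace ℂ (zakAlg e) :=
  Continuous.homeoOfEquivCompactToT2
    (f := Equiv.ofBijective _ ⟨zakCharacter_injective e, zakCharacter_surjective e⟩)
    (continuous_zakCharacter e)

/-- Only compactness of the torus enters the homeomorphism, so the Hausdorff property can be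
transported back. -/
instance : T2Space (Torus e) := (torusHomeomorph e).symm.t2Space

/-- The Gelfand transform of `zakAlg e`, with the torus as character space. -/
def zakGelfand : zakAlg e ≃⋆ₐ[ℂ] C(Torus e, ℂ) :=
  (gelfandStarTransform (zakAlg e)).trans ((torusHomeomorph e).compStarAlgEquiv' ℂ ℂ)

theorem zakGelfand_apply (b : zakAlg e) (p : Torus e) :
    zakGelfand e b p = zakState e p (b : Alg d) := rfl

theorem zakState_zakGelfand_symm (f : C(Torus e, ℂ)) (p : Torus e) :
    zakState e p ((zakGelfand e).symm f) = f p := by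
  rw [← zakGelfand_apply, StarAlgEquiv.apply_symm_apply]

end ZakStates

open MeasureTheory Filter Topology
open scoped BoundedContinuousFunction CompactlySupported

/-! ### Probability measures on the torus and their barycenters -/

section Barycenters

variable {d : ℕ} (e : Module.Basis (Fin d) ℝ (E d))

/-- The real continuous functions on the torus inside the Weyl algebra. -/
def zakQuant (f : C(Torus e, ℝ)) : Alg d :=
  (zakGelfand e).symm (⟨fun p => (f p : ℂ), by fun_prop⟩ : C(Torus e, ℂ))

theorem zakState_zakQuant (f : C(Torus e, ℝ)) (p : Torus e) :
    zakState e p (zakQuant e f) = f p :=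
  zakState_zakGelfand_symm e _ p

theorem zakQuant_add (f g : C(Torus e, ℝ)) :
    zakQuant e (f + g) = zakQuant e f + zakQuant e g := by
  rw [zakQuant, zakQuant, zakQuant, ← AddMemClass.coe_add, ← map_add]
  congr 2
  ext p
  simp

theorem zakQuant_smul (c : ℝ) (f : C(Torus e, ℝ)) :
    zakQuant e (c • f) = (c : ℂ) • zakQuant e f := by
  rw [zakQuant, zakQuant, ← SetLike.val_smul, ← map_smul]
  congr 2
  ext p
  simp

theorem zakQuant_one : zakQuant e 1 = 1 := by
  have h : (⟨fun p => ((1 : C(Torus e, ℝ)) p : ℂ), by fun_prop⟩ : C(Torus e, ℂ)) = 1 := by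
    ext p
    simp
  rw [zakQuant, h, map_one]
  rfl

/-- The continuous function `√f` exhibits `zakQuant e f` in the form `star g * g`. -/
theorem state_zakQuant_nonneg {φ : WeakDual ℂ (Alg d)} (hφ : φ ∈ stateSpace (Alg d))
    {f : C(Torus e, ℝ)} (hf : 0 ≤ f) : 0 ≤ φ (zakQuant e f) := by
  let g : C(Torus e, ℂ) := ⟨fun p => (√(f p) : ℂ), by fun_prop⟩
  have h : (⟨fun p => (f p : ℂ), by fun_prop⟩ : C(Torus e, ℂ)) = star g * g := by
    ext p
    change (f p : ℂ) = star (√(f p) : ℂ) * (√(f p) : ℂ)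
    rw [Complex.star_def, Complex.conj_ofReal, ← Complex.ofReal_mul,
      Real.mul_self_sqrt (show (0 : ℝ) ≤ f p from hf p)]
  rw [zakQuant, h, map_mul, map_star]
  exact hφ.1 _

theorem state_zakQuant_im {φ : WeakDual ℂ (Alg d)} (hφ : φ ∈ stateSpace (Alg d))
    (f : C(Torus e, ℝ)) : (φ (zakQuant e f)).im = 0 := by
  have h1 := nonneg_im (state_zakQuant_nonneg e hφ (f := f + ‖f‖ • 1) fun p => by
    have := (abs_le.1 (f.norm_coe_le_norm p)).1
    simp
    linarith)
  rw [zakQuant_add, zakQuant_smul, zakQuant_one, map_add, map_smul, hφ.2] at h1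
  simpa using h1

/-- The positive functional on the real continuous functions on the torus given by a state. -/
def torusFunctional {φ : WeakDual ℂ (Alg d)} (hφ : φ ∈ stateSpace (Alg d)) :
    C_c(Torus e, ℝ) →ₚ[ℝ] ℝ where
  toFun f := (φ (zakQuant e f)).re
  map_add' f g := by
    have h : ((f + g : C_c(Torus e, ℝ)) : C(Torus e, ℝ)) = (f : C(Torus e, ℝ)) + g := rfl
    rw [h, zakQuant_add, map_add, Complex.add_re]
  map_smul' c f := by
    have h : ((c • f : C_c(Torus e, ℝ)) : C(Torus e, ℝ)) = c • (f : C(Torus e, ℝ)) := rfl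
    rw [h, zakQuant_smul, map_smul]
    simp
  monotone' f g hfg := by
    have h : (g : C(Torus e, ℝ)) = (f : C(Torus e, ℝ)) + ((g : C(Torus e, ℝ)) - f) := by abel
    have h1 := (Complex.nonneg_iff.1 (state_zakQuant_nonneg e hφ
      (f := (g : C(Torus e, ℝ)) - f) (sub_nonneg.2 hfg))).1
    change (φ (zakQuant e f)).re ≤ (φ (zakQuant e g)).re
    rw [h, zakQuant_add, map_add, Complex.add_re]
    linarith

/-- The restriction of a state to the continuous functions on the torus is a probability measure. -/
theorem exists_torusMeasure {φ : WeakDual ℂ (Alg d)} (hφ : φ ∈ stateSpace (Alg d)) :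
    ∃ μ : ProbabilityMeasure (Torus e), ∀ f : C(Torus e, ℝ),
      φ (zakQuant e f) = ((∫ p, f p ∂(μ : Measure (Torus e)) : ℝ) : ℂ) := by
  let Λ := torusFunctional e hφ
  let c (f : C(Torus e, ℝ)) : C_c(Torus e, ℝ) := ⟨f, HasCompactSupport.of_compactSpace _⟩
  have h1 (f : C(Torus e, ℝ)) : ∫ p, f p ∂(RealRMK.rieszMeasure Λ) = (φ (zakQuant e f)).re :=
    RealRMK.integral_rieszMeasure Λ (c f)
  -- The total mass is the value of the state at `zakQuant e 1 = 1`.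
  have hprob : IsProbabilityMeasure (RealRMK.rieszMeasure Λ) := by
    have h2 := h1 1
    rw [zakQuant_one, hφ.2] at h2
    simp only [ContinuousMap.one_apply, integral_const, smul_eq_mul, mul_one, Complex.one_re,
      measureReal_def] at h2
    exact ⟨(ENNReal.toReal_eq_one_iff _).1 h2⟩
  refine ⟨⟨RealRMK.rieszMeasure Λ, hprob⟩, fun f => ?_⟩
  refine Complex.ext ?_ ?_
  · rw [Complex.ofReal_re]
    exact (h1 f).symm
  · rw [Complex.ofReal_im, state_zakQuant_im e hφ]

theorem integrable_zakState (μ : ProbabilityMeasure (Torus e)) (a : Alg d) :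
    Integrable (fun p => zakState e p a) (μ : Measure (Torus e)) :=
  (BoundedContinuousFunction.mkOfCompact ⟨_, continuous_zakState_apply e a⟩).integrable _

/-- The mixture of the pure Zak states with respect to a probability measure on the torus. -/
def barycenter (μ : ProbabilityMeasure (Torus e)) : WeakDual ℂ (Alg d) :=
  StrongDual.toWeakDual <| LinearMap.mkContinuous
    { toFun := fun a => ∫ p, zakState e p a ∂(μ : Measure (Torus e))
      map_add' := fun a b => by
        simp only [map_add]
        exact integral_add (integrable_zakState e μ a) (integrable_zakState e μ b)
      map_smul' := fun c a => by
        simp only [map_smul]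
        exact integral_smul c _ } 1 fun a => by
      rw [one_mul]
      refine (norm_integral_le_of_norm_le_const (.of_forall fun p => norm_zakState_le e p a)).trans
        ?_
      simp

theorem barycenter_apply (μ : ProbabilityMeasure (Torus e)) (a : Alg d) :
    barycenter e μ a = ∫ p, zakState e p a ∂(μ : Measure (Torus e)) := rfl

theorem barycenter_mem_zakStates (μ : ProbabilityMeasure (Torus e)) :
    barycenter e μ ∈ zakStates e := by
  have h1 : barycenter e μ 1 = 1 := by
    rw [barycenter_apply]
    simp only [(zakState_mem_stateSpace e _).2]
    simp
  refine ⟨mem_stateSpace_of_norm_le h1 fun a => ?_, fun γ hγ γ' hγ' a => ?_⟩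
  · refine (norm_integral_le_of_norm_le_const (.of_forall fun p => norm_zakState_le e p a)).trans ?_
    simp
  · rw [barycenter_apply, barycenter_apply]
    refine integral_congr_ae (.of_forall fun p => ?_)
    exact (zakState_mem_zakStates e p).2 γ hγ γ' hγ' a

theorem barycenter_zakQuant (μ : ProbabilityMeasure (Torus e)) (f : C(Torus e, ℝ)) :
    barycenter e μ (zakQuant e f) = ((∫ p, f p ∂(μ : Measure (Torus e)) : ℝ) : ℂ) := by
  rw [barycenter_apply]
  simp only [zakState_zakQuant]
  exact integral_ofReal

theorem eq_zakQuant_add (b : zakAlg e) : ∃ f g : C(Torus e, ℝ),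
    (b : Alg d) = zakQuant e f + Complex.I • zakQuant e g := by
  let F := zakGelfand e b
  refine ⟨⟨fun p => (F p).re, by fun_prop⟩, ⟨fun p => (F p).im, by fun_prop⟩, ?_⟩
  rw [zakQuant, zakQuant, ← SetLike.val_smul, ← map_smul, ← AddMemClass.coe_add, ← map_add]
  conv_lhs => rw [← (zakGelfand e).symm_apply_apply b]
  congr 2
  ext p
  change F p = ((F p).re : ℂ) + Complex.I * ((F p).im : ℂ)
  rw [mul_comm, Complex.re_add_im]

/-- Real and imaginary parts of Gelfand transforms recover all of `zakAlg`, in particular the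
lattice monomials, which determine a Zak state. -/
theorem zakState_eq_of_zakQuant {φ ψ : WeakDual ℂ (Alg d)} (hφ : φ ∈ zakStates e)
    (hψ : ψ ∈ zakStates e) (h : ∀ f, φ (zakQuant e f) = ψ (zakQuant e f)) : φ = ψ := by
  refine zakState_ext e hφ hψ fun l hl => ?_
  obtain ⟨f, g, hfg⟩ := eq_zakQuant_add e ⟨weyl l, weyl_mem_zakAlg e hl⟩
  change weyl l = _ at hfg
  rw [hfg, map_add, map_add, map_smul, map_smul, h, h]

theorem exists_barycenter_eq {φ : WeakDual ℂ (Alg d)} (hφ : φ ∈ zakStates e) :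
    ∃ μ : ProbabilityMeasure (Torus e), barycenter e μ = φ := by
  obtain ⟨μ, hμ⟩ := exists_torusMeasure e hφ.1
  exact ⟨μ, zakState_eq_of_zakQuant e (barycenter_mem_zakStates e μ) hφ fun f => by
    rw [hμ, barycenter_zakQuant]⟩

/-- Evaluating at `zakQuant e f` returns the integral of `f`, and these integrals determine the
measure. -/
theorem barycenter_injective : Function.Injective (barycenter e) := by
  intro μ ν h
  have hμ : IsProbabilityMeasure μ.1 := μ.2
  have hν : IsProbabilityMeasure ν.1 := ν.2
  refine Subtype.ext (ext_of_forall_integral_eq_of_IsFiniteMeasure fun f => ?_)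
  have h1 := congrArg (fun φ : WeakDual ℂ (Alg d) => φ (zakQuant e f.toContinuousMap)) h
  simp only [barycenter_zakQuant, Complex.ofReal_inj] at h1
  exact h1

theorem continuous_barycenter : Continuous (barycenter e) := by
  refine WeakDual.continuous_of_continuous_eval fun a => ?_
  rw [continuous_iff_continuousAt]
  intro μ
  exact (ProbabilityMeasure.tendsto_iff_forall_integral_rclike_tendsto ℂ).1 tendsto_id
    (BoundedContinuousFunction.mkOfCompact ⟨_, continuous_zakState_apply e a⟩)

/-- The Zak states are the probability measures on the torus. -/
def zakStatesHomeomorph : zakStates e ≃ₜ ProbabilityMeasure (Torus e) where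
  toFun ω := (exists_barycenter_eq e ω.2).choose
  invFun μ := ⟨barycenter e μ, barycenter_mem_zakStates e μ⟩
  left_inv ω := Subtype.ext (exists_barycenter_eq e ω.2).choose_spec
  right_inv μ := barycenter_injective e
    (exists_barycenter_eq e (barycenter_mem_zakStates e μ)).choose_spec
  -- The integral of `f` against the measure of `ω` is `Re ω (zakQuant e f)`, an evaluation and
  -- hence weak-* continuous in `ω`.
  continuous_toFun := by
    rw [continuous_iff_continuousAt]
    intro ω
    refine ProbabilityMeasure.tendsto_iff_forall_integral_tendsto.2 fun f => ?_
    have h (ω : zakStates e) :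
        ∫ p, f p ∂((exists_barycenter_eq e ω.2).choose : Measure (Torus e)) =
          (ω.1 (zakQuant e f.toContinuousMap)).re := by
      have h1 := barycenter_zakQuant e (exists_barycenter_eq e ω.2).choose f.toContinuousMap
      rw [(exists_barycenter_eq e ω.2).choose_spec] at h1
      rw [h1, Complex.ofReal_re]
      rfl
    simp only [h]
    exact (Complex.continuous_re.comp
      ((WeakDual.eval_continuous _).comp continuous_subtype_val)).tendsto ω
  continuous_invFun := (continuous_barycenter e).subtype_mk _

theorem barycenter_zakStatesHomeomorph (ω : zakStates e) :
    barycenter e (zakStatesHomeomorph e ω) = ω.1 :=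
  (exists_barycenter_eq e ω.2).choose_spec

end Barycenters

end Weyl

end

/-! ### The main theorem -/

theorem mainTheorem8 (d : ℕ) (e : Module.Basis (Fin d) ℝ (EuclideanSpace ℝ (Fin d))) :
    ∃ P : Weyl.Torus e → Weyl.pureZakStates e,
      (∀ κ ν α β : EuclideanSpace ℝ (Fin d),
        (P (Weyl.Torus.mk e κ ν)).1 (Weyl.Alg.u α * Weyl.Alg.v β) =
          (Weyl.dualLattice e : Set (EuclideanSpace ℝ (Fin d))).indicator 1 α *
          (Weyl.lattice e : Set (EuclideanSpace ℝ (Fin d))).indicator 1 β *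
          Complex.exp (-(Complex.I * (inner ℝ κ β : ℝ))) *
          Complex.exp (-(Complex.I * (inner ℝ α ν : ℝ)))) ∧
      ∃ Φ : Weyl.zakStates e ≃ₜ MeasureTheory.ProbabilityMeasure (Weyl.Torus e),
        ∀ ω : Weyl.zakStates e,
          (∀ a : Weyl.Alg d,
            MeasureTheory.Integrable (fun p => (P p).1 a)
              (Φ ω : MeasureTheory.Measure (Weyl.Torus e)) ∧
            ω.1 a = ∫ p, (P p).1 a ∂(Φ ω : MeasureTheory.Measure (Weyl.Torus e))) ∧
          ∀ μ : MeasureTheory.ProbabilityMeasure (Weyl.Torus e),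
            (∀ a : Weyl.Alg d,
              ω.1 a = ∫ p, (P p).1 a ∂(μ : MeasureTheory.Measure (Weyl.Torus e))) →
            μ = Φ ω := by
  refine ⟨fun p => ⟨Weyl.zakState e p, Weyl.zakState_mem_pureZakStates e p⟩,
    fun κ ν α β => ?_, Weyl.zakStatesHomeomorph e, fun ω => ⟨fun a => ⟨?_, ?_⟩, fun μ hμ => ?_⟩⟩
  · change Weyl.zakState e _ _ = _
    rw [Weyl.u_mul_v]
    by_cases h : (α, β) ∈ Weyl.phaseLattice e
    · have hα : α ∈ (Weyl.dualLattice e : Set (EuclideanSpace ℝ (Fin d))) := h.1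
      have hβ : β ∈ (Weyl.lattice e : Set (EuclideanSpace ℝ (Fin d))) := h.2
      rw [Weyl.zakState_mk e κ ν h, Set.indicator_of_mem hα, Set.indicator_of_mem hβ]
      simp [Weyl.chi, Weyl.PreAlg.phase]
    · rw [Weyl.zakState_weyl_eq_zero e (Weyl.zakState_mem_zakStates e _) h]
      rw [Weyl.mem_phaseLattice, not_and_or] at h
      rcases h with h | h
      · have hα : α ∉ (Weyl.dualLattice e : Set (EuclideanSpace ℝ (Fin d))) := h
        rw [Set.indicator_of_notMem hα]
        simp
      · have hβ : β ∉ (Weyl.lattice e : Set (EuclideanSpace ℝ (Fin d))) := h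
        rw [Set.indicator_of_notMem hβ]
        simp
  · exact Weyl.integrable_zakState e _ a
  · rw [← Weyl.barycenter_zakStatesHomeomorph e ω]
    rfl
  · refine Weyl.barycenter_injective e ?_
    rw [Weyl.barycenter_zakStatesHomeomorph]
    exact ContinuousLinearMap.ext fun a => (hμ a).symm
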